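/- Conventions. A tt-category $\mathcal K$ is a triangulated category with suspension $\Sigma$ and a symmetric monoidal structure $(\otimes,\mathbb 1)$ that is exact in each variable; it is rigid if every object has a dual. $\mathrm{Spc}(\mathcal K)$ is the space of prime tt-ideals $\mathcal P$, with the topology generated by the sets $\{\mathcal P\mid a\in\mathcal P\}$, $a\in\mathcal K$. For a morphism $s$ put $U(s)=\{\mathcal P\mid \mathrm{cone}(s)\in\mathcal P\}$. The period of a tt-category is the smallest $d>0$ with $\mathbb 1\cong\Sigma^d\mathbb 1$, or $0$ if there is none; the local period is $\mathrm{per}_{\mathcal K}(\mathcal P)=\mathrm{per}(\mathcal K/\mathcal P)$, where $\mathcal K/\mathcal P$ is the Verdier quotient. The period of a $\mathbb Z$-graded ring is the smallest degree $d>0$ of a homogeneous unit, or $0$ if there is none. For a homogeneous prime $\mathfrak q$ of a graded ring $R$ put $\mathrm{per}_R(\mathfrak q)=\mathrm{per}(R_{\mathfrak q})$, where $R_{\mathfrak q}$ is obtained from $R$ by inverting all homogeneous elements outside $\mathfrak q$. Let $R_{\mathcal K}=\bigoplus_{d\in\mathbb Z}\mathrm{Hom}_{\mathcal K}(\Sigma^d\mathbb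 1,\mathbb 1)$ be the graded endomorphism ring of the unit. A line bundle is a $\otimes$-invertible object that is, locally on $\mathrm{Spc}(\mathcal K)$, isomorphic to a shift of $\mathbb 1$; it is base-free if the sets $U(s)$, for $s\colon\mathbb 1\to\Sigma^dx$ and $d\in\mathbb Z$, cover $\mathrm{Spc}(\mathcal K)$. Let $x_1,\dots,x_N$ be line bundles, and let $M\subseteq\mathrm{Pic}(\mathcal K)$ be the submonoid generated by them and by all shifts $\Sigma^d\mathbb 1$, $d\in\mathbb Z$. The family is ample if the sets $U(s)$, for $s\colon\mathbb 1\to m$ and $m\in M$, form a basis of the topology of $\mathrm{Spc}(\mathcal K)$. The central 2-ring $\mathcal R_M$ has as objects the objects $g$ of $\mathcal K$ whose class lies in the subgroup of $\mathrm{Pic}(\mathcal K)$ generated by $M$, and $\mathcal R_M(g,h)=\mathcal K(g,h)$ if $h\cong m\otimes g$ for some $m\in M$, and $\mathcal R_M(g,h)=0$ otherwise. A homogeneous prime of $\mathcal R_M$ is a proper ideal of morphisms, closed under tensoring with objects, such that $s\circ r\in\mathfrak p$ implies $s\in\mathfrak p$ or $r\in\mathfrak p$. The points of the graded scheme $P\{x_i\}$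 are the homogeneous primes $\mathfrak p$ of $\mathcal R_M$ for which there are sections $s_i\colon\mathbb 1\to\Sigma^{d_i}x_i$ with $s_i\notin\mathfrak p$ for all $i$. For each such choice $\underline s=(s_i)_i$ the open set $D(\underline s)=\{\mathfrak p\mid s_i\notin\mathfrak p\text{ for all }i\}$ is an affine chart, identified with the homogeneous spectrum of the graded ring $R_{\mathcal K[\underline s^{-1}]}$, where $\mathcal K[\underline s^{-1}]=\mathcal K/\langle\mathrm{cone}(s_1),\dots,\mathrm{cone}(s_N)\rangle$; a point $\mathfrak p$ corresponds to the homogeneous prime $\mathfrak p_{\underline s}$ generated by the fractions $b\circ t^{-1}\colon\Sigma^d\mathbb 1\to\mathbb 1$ with $b\in\mathfrak p$ and $t$ a morphism of $\mathcal R_M$ that is invertible in $\mathcal K[\underline s^{-1}]$. The local graded ring of $P\{x_i\}$ at $\mathfrak p$ is $(R_{\mathcal K[\underline s^{-1}]})_{\mathfrak p_{\underline s}}$, and $\mathrm{per}_{P\{x_i\}}(\mathfrak p)$ is its period. Theorem. Let $\mathcal K$ be a rigid (essentially small) tt-category. (1) Let $x_1,\dots,x_N$ be a finite ample family of base-free line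 bundles of $\mathcal K$. Then $\mathcal P\mapsto\mathfrak p=\{r\in\mathcal R_M\mid\mathrm{cone}(r)\notin\mathcal P\}$ is a well-defined map from $\mathrm{Spc}(\mathcal K)$ to the set of homogeneous primes of $\mathcal R_M$. For each $\mathcal P\in\mathrm{Spc}(\mathcal K)$ the image $\mathfrak p$ lies in $P\{x_i\}$, and $$\mathrm{per}_{\mathcal K}(\mathcal P)=\mathrm{per}_{P\{x_i\}}(\mathfrak p),$$ where the right hand side may be computed in any chart $D(\underline s)$ that contains $\mathfrak p$. (2) There is a map $\mathrm{comp}_{\mathcal K}\colon\mathrm{Spc}(\mathcal K)\to\mathrm{Spc}^{\mathrm h}(R_{\mathcal K})$ to the homogeneous spectrum, such that a homogeneous element $f$ lies in $\mathrm{comp}_{\mathcal K}(\mathcal P)$ if and only if $\mathrm{cone}(f)\notin\mathcal P$. If $\mathrm{comp}_{\mathcal K}$ is a homeomorphism onto its image, then $\mathrm{per}_{\mathcal K}(\mathcal P)=\mathrm{per}_{R_{\mathcal K}}(\mathrm{comp}_{\mathcal K}(\mathcal P))$ for every $\mathcal P\in\mathrm{Spc}(\mathcal K)$. -/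

import Mathlib

open CategoryTheory MonoidalCategory Limits Pretriangulated

universe v u w

noncomputable section

namespace TTPeriod

/-! ## Graded rings: homogeneous primes, localization, periods -/

section GradedRings

variable (A : ℤ → Type w) [∀ d, AddCommGroup (A d)] [DirectSum.GRing A]

/-- The `ℤ`-graded ring `R = ⨁ d, A d`. -/
abbrev Total : Type w := DirectSum ℤ A

variable {A} in
/-- The element of `R` given by an element of degree `d`. -/
abbrev hom {d : ℤ} (a : A d) : Total A := DirectSum.of A d a

/-- The period of a graded ring `L`, where `H d` is the set of elements of degree `d`: the smallest
`d > 0` such that there is a unit of degree `d`, and `0` if there is none (`sInf ∅ = 0`). -/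
def gradedPeriod {L : Type*} [Ring L] (H : ℤ → Set L) : ℕ :=
  sInf {d : ℕ | 0 < d ∧ ∃ l ∈ H (d : ℤ), IsUnit l}

/-- A homogeneous prime ideal of `R = ⨁ d, A d`: a proper two-sided ideal, containing the
homogeneous components of its elements, and prime with respect to homogeneous elements. -/
@[ext]
structure HomogeneousPrime where
  toIdeal : Ideal (Total A)
  mul_mem_right : ∀ a b, a ∈ toIdeal → a * b ∈ toIdeal
  component_mem : ∀ a ∈ toIdeal, ∀ d : ℤ, hom (a d) ∈ toIdeal
  ne_top : toIdeal ≠ ⊤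
  mem_or_mem : ∀ (d e : ℤ) (a : A d) (b : A e),
    hom a * hom b ∈ toIdeal → hom a ∈ toIdeal ∨ hom b ∈ toIdeal

/-- The Zariski topology on the homogeneous spectrum, generated by the sets
`D(f) = {𝔭 | f ∉ 𝔭}` with `f` homogeneous. -/
instance : TopologicalSpace (HomogeneousPrime A) :=
  TopologicalSpace.generateFrom
    {U | ∃ (d : ℤ) (f : A d), U = {𝔭 : HomogeneousPrime A | hom f ∉ 𝔭.toIdeal}}

variable {A}

/-- The homogeneous elements of `R` (together with a degree) outside of `I`. -/
def HomCompl (I : Ideal (Total A)) : Type w := {s : (d : ℤ) × A d // hom s.2 ∉ I}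

/-- The relations which express that the letters `Sum.inl r` multiply and add up as the elements
`r` of `R`, and that the letter `Sum.inr s` is a two-sided inverse of `Sum.inl s`. -/
inductive LocRel (I : Ideal (Total A)) :
    FreeAlgebra ℤ (Total A ⊕ HomCompl I) → FreeAlgebra ℤ (Total A ⊕ HomCompl I) → Prop
  | one : LocRel I (FreeAlgebra.ι ℤ (Sum.inl 1)) 1
  | add (r r' : Total A) : LocRel I (FreeAlgebra.ι ℤ (Sum.inl (r + r')))
      (FreeAlgebra.ι ℤ (Sum.inl r) + FreeAlgebra.ι ℤ (Sum.inl r'))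
  | mul (r r' : Total A) : LocRel I (FreeAlgebra.ι ℤ (Sum.inl (r * r')))
      (FreeAlgebra.ι ℤ (Sum.inl r) * FreeAlgebra.ι ℤ (Sum.inl r'))
  | mul_inv (s : HomCompl I) : LocRel I
      (FreeAlgebra.ι ℤ (Sum.inl (hom s.1.2)) * FreeAlgebra.ι ℤ (Sum.inr s)) 1
  | inv_mul (s : HomCompl I) : LocRel I
      (FreeAlgebra.ι ℤ (Sum.inr s) * FreeAlgebra.ι ℤ (Sum.inl (hom s.1.2))) 1

/-- The localization of `R` at `I`: the ring obtained from `R` by universally inverting all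
homogeneous elements outside of `I`. In the rings `R` of interest homogeneous elements commute up
to units of degree `0`, so that for a homogeneous prime `I` this is the usual graded local ring
`R_I`, whose elements of degree `d` are the fractions `a / s` with `s ∉ I` homogeneous and `a` of
degree `d + deg s`. -/
abbrev LocalRing (I : Ideal (Total A)) : Type w := RingQuot (LocRel I)

/-- The canonical map from `R` to its localization. -/
def LocalRing.ofRing (I : Ideal (Total A)) (r : Total A) : LocalRing I :=
  RingQuot.mkRingHom _ (FreeAlgebra.ι ℤ (Sum.inl r))

/-- The inverse of a homogeneous element outside of `I` in the localization. -/
def LocalRing.inv (I : Ideal (Total A)) (s : HomCompl I) : LocalRing I :=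
  RingQuot.mkRingHom _ (FreeAlgebra.ι ℤ (Sum.inr s))

/-- The grading of the localization: `LocalRing.IsHomogeneous I d l` says that `l` is of degree
`d`. -/
inductive LocalRing.IsHomogeneous (I : Ideal (Total A)) : ℤ → LocalRing I → Prop
  | ofRing {d : ℤ} (a : A d) : IsHomogeneous I d (LocalRing.ofRing I (hom a))
  | inv (s : HomCompl I) : IsHomogeneous I (-s.1.1) (LocalRing.inv I s)
  | add {d : ℤ} {l l' : LocalRing I} :
      IsHomogeneous I d l → IsHomogeneous I d l' → IsHomogeneous I d (l + l')
  | mul {d e : ℤ} {l l' : LocalRing I} :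
      IsHomogeneous I d l → IsHomogeneous I e l' → IsHomogeneous I (d + e) (l * l')

/-- The local period of `R` at `I`: the period of the graded local ring at `I`. -/
def ringPeriodAt (I : Ideal (Total A)) : ℕ :=
  gradedPeriod (fun d => {l : LocalRing I | LocalRing.IsHomogeneous I d l})

end GradedRings

/-! ## The graded endomorphism ring of an object -/

section GradedEnd

variable {C : Type u} [Category.{v} C] [HasShift C ℤ]

/-- The product of `f : Σᵐ X ⟶ X` and `g : Σⁿ X ⟶ X` is
`f ∘ Σᵐ g : Σᵐ⁺ⁿ X = Σᵐ Σⁿ X ⟶ Σᵐ X ⟶ X`. -/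
def shiftMul {X : C} {m n k : ℤ} (f : X⟦m⟧ ⟶ X) (g : X⟦n⟧ ⟶ X) (h : n + m = k) : X⟦k⟧ ⟶ X :=
  (shiftFunctorAdd' C n m k h).hom.app X ≫ g⟦m⟧' ≫ f

theorem one_shiftMul {X : C} {n : ℤ} (g : X⟦n⟧ ⟶ X) :
    shiftMul ((shiftFunctorZero C ℤ).hom.app X) g (add_zero n) = g := by
  have := (shiftFunctorZero C ℤ).hom.naturality g
  dsimp [shiftMul] at this ⊢
  rw [this, shiftFunctorAdd'_add_zero_hom_app]
  simp

theorem shiftMul_one {X : C} {n : ℤ} (g : X⟦n⟧ ⟶ X) :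
    shiftMul g ((shiftFunctorZero C ℤ).hom.app X) (zero_add n) = g := by
  dsimp [shiftMul]
  rw [shiftFunctorAdd'_zero_add_hom_app, ← Functor.map_comp_assoc]
  simp

theorem shiftMul_assoc {X : C} {a b c ab bc k : ℤ} (f : X⟦a⟧ ⟶ X) (g : X⟦b⟧ ⟶ X) (h : X⟦c⟧ ⟶ X)
    (hab : b + a = ab) (hbc : c + b = bc) (hk : c + ab = k) (hk' : bc + a = k) :
    shiftMul (shiftMul f g hab) h hk = shiftMul f (shiftMul g h hbc) hk' := by
  have h₁ := (shiftFunctorAdd' C b a ab hab).hom.naturality h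
  have h₂ := shiftFunctorAdd'_assoc_hom_app (C := C) c b a bc ab k hbc hab (by omega) X
  dsimp [shiftMul] at h₁ ⊢
  simp only [Functor.map_comp, Category.assoc]
  rw [reassoc_of% h₁, ← reassoc_of% h₂]

theorem mk_shiftMul {X : C} {m n k k' : ℤ} (f : X⟦m⟧ ⟶ X) (g : X⟦n⟧ ⟶ X) (h : n + m = k)
    (h' : n + m = k') :
    (⟨k, shiftMul f g h⟩ : (d : ℤ) × (X⟦d⟧ ⟶ X)) = ⟨k', shiftMul f g h'⟩ := by
  subst h; subst h'; rfl

/-- The morphisms `Σᵈ X ⟶ X`. -/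
def GEnd (X : C) (d : ℤ) : Type v := X⟦d⟧ ⟶ X

instance GEnd.instGMul (X : C) : GradedMonoid.GMul (GEnd X) where
  mul {m n} f g := shiftMul (X := X) (m := m) (n := n) f g (add_comm _ _)

instance GEnd.instGOne (X : C) : GradedMonoid.GOne (GEnd X) where
  one := (shiftFunctorZero C ℤ).hom.app X

instance GEnd.instGMonoid (X : C) : GradedMonoid.GMonoid (GEnd X) where
  one_mul := by
    rintro ⟨n, g⟩
    exact (mk_shiftMul (X := X) _ _ _ (add_zero n)).trans (congrArg (Sigma.mk n) (one_shiftMul g))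
  mul_one := by
    rintro ⟨n, g⟩
    exact (mk_shiftMul (X := X) _ _ _ (zero_add n)).trans (congrArg (Sigma.mk n) (shiftMul_one g))
  mul_assoc := by
    rintro ⟨a, f⟩ ⟨b, g⟩ ⟨c, h⟩
    exact (congrArg (Sigma.mk (a + b + c)) (shiftMul_assoc (X := X) f g h (add_comm b a)
      (add_comm c b) (add_comm c (a + b)) (by omega))).trans (mk_shiftMul (X := X) _ _ _ _)

variable [Preadditive C]

instance (X : C) (d : ℤ) : AddCommGroup (GEnd X d) :=
  inferInstanceAs (AddCommGroup (X⟦d⟧ ⟶ X))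

theorem zero_shiftMul {X : C} {m n k : ℤ} (g : X⟦n⟧ ⟶ X) (h : n + m = k) :
    shiftMul (0 : X⟦m⟧ ⟶ X) g h = 0 := by
  simp [shiftMul]

theorem add_shiftMul {X : C} {m n k : ℤ} (f f' : X⟦m⟧ ⟶ X) (g : X⟦n⟧ ⟶ X) (h : n + m = k) :
    shiftMul (f + f') g h = shiftMul f g h + shiftMul f' g h := by
  simp [shiftMul]

variable [∀ n : ℤ, (shiftFunctor C n).Additive]

theorem shiftMul_zero {X : C} {m n k : ℤ} (f : X⟦m⟧ ⟶ X) (h : n + m = k) :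
    shiftMul f (0 : X⟦n⟧ ⟶ X) h = 0 := by
  simp [shiftMul]

theorem shiftMul_add {X : C} {m n k : ℤ} (f : X⟦m⟧ ⟶ X) (g g' : X⟦n⟧ ⟶ X) (h : n + m = k) :
    shiftMul f (g + g') h = shiftMul f g h + shiftMul f g' h := by
  simp [shiftMul, Functor.map_add]

/-- The graded endomorphism ring `⨁ d, Hom(Σᵈ X, X)`. -/
instance GEnd.instGRing (X : C) : DirectSum.GRing (GEnd X) where
  __ := GEnd.instGMonoid X
  mul_zero _ := shiftMul_zero (X := X) _ _
  zero_mul _ := zero_shiftMul (X := X) _ _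
  mul_add _ _ _ := shiftMul_add (X := X) _ _ _ _
  add_mul _ _ _ := add_shiftMul (X := X) _ _ _ _
  natCast n := n • (show GEnd X 0 from (shiftFunctorZero C ℤ).hom.app X)
  natCast_zero := zero_smul _ _
  natCast_succ n := succ_nsmul _ n
  intCast n := n • (show GEnd X 0 from (shiftFunctorZero C ℤ).hom.app X)
  intCast_ofNat n := natCast_zsmul _ n
  intCast_negSucc_ofNat n := negSucc_zsmul _ n

/-- The smallest `d > 0` with `X ≅ Σᵈ X`, and `0` if there is none (`sInf ∅ = 0`). The period of a
tt-category is this number for its unit object. -/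
def objPeriod (X : C) : ℕ :=
  sInf {d : ℕ | 0 < d ∧ Nonempty (X ≅ X⟦(d : ℤ)⟧)}

end GradedEnd

/-! ## Tensor triangulated categories and their spectra -/

/-- A tensor triangulated category: a triangulated category with a symmetric monoidal structure
such that `a ⊗ -` (and hence, by symmetry, `- ⊗ a`) is exact; the isomorphisms
`a ⊗ Σⁿ x ≅ Σⁿ (a ⊗ x)` are natural in both variables. -/
class TensorTriangulated (K : Type u) [Category.{v} K] [HasZeroObject K] [HasShift K ℤ]
    [Preadditive K] [∀ n : ℤ, (shiftFunctor K n).Additive] [Pretriangulated K]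
    [MonoidalCategory K] [SymmetricCategory K] where
  isTriangulated : IsTriangulated K
  commShift (a : K) : (tensorLeft a).CommShift ℤ
  exact (a : K) : (tensorLeft a).IsTriangulated
  natural {a b : K} (f : a ⟶ b) (x : K) (n : ℤ) :
    f ▷ (x⟦n⟧) ≫ ((tensorLeft b).commShiftIso n).hom.app x =
      ((tensorLeft a).commShiftIso n).hom.app x ≫ (f ▷ x)⟦n⟧'

attribute [instance] TensorTriangulated.isTriangulated TensorTriangulated.commShift
  TensorTriangulated.exact

section Spectrum

variable (K : Type u) [Category.{v} K] [HasZeroObject K] [HasShift K ℤ]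
  [Preadditive K] [∀ n : ℤ, (shiftFunctor K n).Additive] [Pretriangulated K]
  [MonoidalCategory K]

/-- A tt-ideal: a thick triangulated subcategory which is closed under tensoring with arbitrary
objects. -/
@[ext]
structure ThickIdeal where
  carrier : ObjectProperty K
  isTriangulated : carrier.IsTriangulated
  isClosedUnderIsomorphisms : carrier.IsClosedUnderIsomorphisms
  isStableUnderRetracts : carrier.IsStableUnderRetracts
  tensor_mem (a x : K) : carrier x → carrier (a ⊗ x)

attribute [instance] ThickIdeal.isTriangulated ThickIdeal.isClosedUnderIsomorphisms
  ThickIdeal.isStableUnderRetracts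

variable {K}

/-- The smallest tt-ideal which contains the objects in `S`. -/
def ThickIdeal.generatedBy (S : ObjectProperty K) : ThickIdeal K where
  carrier x := ∀ I : ThickIdeal K, S ≤ I.carrier → I.carrier x
  isClosedUnderIsomorphisms := ⟨fun e h I hI => I.carrier.prop_of_iso e (h I hI)⟩
  isStableUnderRetracts := ⟨fun r h I hI => I.carrier.prop_of_retract r (h I hI)⟩
  isTriangulated :=
    { exists_zero := ⟨_, isZero_zero K, fun I _ => I.carrier.prop_zero⟩
      isStableUnderShiftBy := fun n => ⟨fun _ h I hI => I.carrier.le_shift n _ (h I hI)⟩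
      ext₂' := fun T hT h₁ h₃ => ObjectProperty.le_isoClosure _ _ fun I hI =>
        I.carrier.ext_of_isTriangulatedClosed₂ T hT (h₁ I hI) (h₃ I hI) }
  tensor_mem a x h I hI := I.tensor_mem a x (h I hI)

variable (K)

/-- The spectrum of a tt-category: the set of its prime tt-ideals. -/
@[ext]
structure Spectrum extends ThickIdeal K where
  unit_notMem : ¬ carrier (𝟙_ K)
  mem_or_mem (a b : K) : carrier (a ⊗ b) → carrier a ∨ carrier b

/-- The topology on the spectrum generated by the sets `U(a) = {P | a ∈ P}`. -/
instance : TopologicalSpace (Spectrum K) :=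
  TopologicalSpace.generateFrom {U | ∃ a : K, U = {P : Spectrum K | P.carrier a}}

variable {K}

/-- `ConeMem P f` says that (one, equivalently every) cone of `f` belongs to `P`. -/
abbrev Spectrum.ConeMem (P : Spectrum K) {a b : K} (f : a ⟶ b) : Prop := P.carrier.trW f

/-- The open set `U(s)`, the complement of the support of the cone of `s`. -/
def invLocus {a b : K} (s : a ⟶ b) : Set (Spectrum K) := {P | P.ConeMem s}

/-- The objects whose support `{P | a ∉ P}` is contained in `Z`. -/
def supportedOn (Z : Set (Spectrum K)) : ObjectProperty K :=
  fun a => ∀ P : Spectrum K, ¬ P.carrier a → P ∈ Z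

variable [IsTriangulated K]

/-- The Verdier quotient `K / I`. -/
abbrev ThickIdeal.Quotient (I : ThickIdeal K) := I.carrier.trW.Localization

/-- The unit of the tt-category `K / I`, the image of the unit of `K`. -/
abbrev ThickIdeal.unit (I : ThickIdeal K) : I.Quotient := I.carrier.trW.Q.obj (𝟙_ K)

/-- The local period of `K` at `P`, which is the period of the tt-category `K / P`. -/
def Spectrum.period (P : Spectrum K) : ℕ := objPeriod P.toThickIdeal.unit

/-! ## Line bundles and ample families -/

variable (K) in
/-- Every object has a dual. -/
def IsRigid : Prop := ∀ x : K, ∃ y : K, Nonempty (ExactPairing x y)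

/-- A line bundle: an invertible object `x` such that every point of the spectrum has a
quasi-compact open neighborhood `U` for which `x` is isomorphic to a shift of the unit in the
category `K|_U = K / {a | supp a ⊆ Uᶜ}`. -/
def IsLineBundle (x : K) : Prop :=
  (∃ y : K, Nonempty (x ⊗ y ≅ 𝟙_ K)) ∧
    ∀ P : Spectrum K, ∃ U : Set (Spectrum K), IsOpen U ∧ IsCompact U ∧ P ∈ U ∧
      ∃ d : ℤ, Nonempty ((supportedOn Uᶜ).trW.Q.obj x ≅ (supportedOn Uᶜ).trW.Q.obj ((𝟙_ K)⟦d⟧))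

/-- The line bundle `x` is base-free: the sets `U(s)`, for `s` a global section of `x` of some
degree, cover the spectrum. -/
def IsBaseFree (x : K) : Prop :=
  ∀ P : Spectrum K, ∃ (d : ℤ) (s : 𝟙_ K ⟶ x⟦d⟧), P ∈ invLocus s

section Family

variable {ι : Type} (x : ι → K)

/-- The submonoid `M` of the Picard group generated by the `x i` and the shifts of the unit (as a
property of objects, closed under isomorphisms). -/
inductive PicMonoid : K → Prop
  | of (i : ι) : PicMonoid (x i)
  | shift (d : ℤ) : PicMonoid ((𝟙_ K)⟦d⟧)
  | tensor {a b : K} : PicMonoid a → PicMonoid b → PicMonoid (a ⊗ b)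
  | iso {a b : K} : (a ≅ b) → PicMonoid a → PicMonoid b

/-- The family `x` is ample: the sets `U(s)`, where `s : 𝟙 ⟶ m` runs through the global sections of
all objects `m` of `M`, form a basis for the topology of the spectrum. -/
def IsAmple : Prop :=
  TopologicalSpace.IsTopologicalBasis
    {U : Set (Spectrum K) | ∃ (m : K) (_ : PicMonoid x m) (s : 𝟙_ K ⟶ m), U = invLocus s}

/-! ## The central 2-ring of `M` and its spectrum -/

/-- The objects of the group completion of `M`: all `m ⊗ n⁻¹` with `m` and `n` in `M`. -/
def PicGroup (g : K) : Prop :=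
  ∃ m n : K, PicMonoid x m ∧ PicMonoid x n ∧ Nonempty (g ⊗ n ≅ m)

/-- The morphisms of the `M`-graded central 2-ring `R_M`: its objects are those of the group
completion of `M`, and the morphisms from `g` to `h` are all morphisms of `K` if `h ≅ m ⊗ g` for some
`m` in `M`, and only `0` otherwise. -/
def centralRing : MorphismProperty K :=
  fun g h f => PicGroup x g ∧ PicGroup x h ∧
    ((∃ m : K, PicMonoid x m ∧ Nonempty (h ≅ m ⊗ g)) ∨ f = 0)

/-- The homogeneous prime ideals of `R_M`, that is, the points of the spectrum of `R_M`. -/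
@[ext]
structure CentralPrime where
  carrier : MorphismProperty K
  le_centralRing : carrier ≤ centralRing x
  zero_mem (g h : K) : PicGroup x g → PicGroup x h → carrier (0 : g ⟶ h)
  add_mem {g h : K} (r r' : g ⟶ h) : carrier r → carrier r' → carrier (r + r')
  comp_mem {g h k : K} (r : g ⟶ h) (t : h ⟶ k) : carrier r → centralRing x t → carrier (r ≫ t)
  mem_comp {g h k : K} (t : g ⟶ h) (r : h ⟶ k) : centralRing x t → carrier r → carrier (t ≫ r)
  whiskerLeft_mem (k : K) {g h : K} (r : g ⟶ h) : PicGroup x k → carrier r → carrier (k ◁ r)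
  whiskerRight_mem {g h : K} (r : g ⟶ h) (k : K) : PicGroup x k → carrier r → carrier (r ▷ k)
  ne_top : carrier ≠ centralRing x
  mem_or_mem {g h k : K} (r : g ⟶ h) (s : h ⟶ k) : centralRing x r → centralRing x s →
    carrier (r ≫ s) → carrier r ∨ carrier s

/-! ## The graded scheme `P{x i}` -/

/-- A choice of a global section `s i` of some degree of every `x i`; it gives a chart of the graded
scheme `P{x i}`. -/
structure Chart where
  deg : ι → ℤ
  sec (i : ι) : 𝟙_ K ⟶ (x i)⟦deg i⟧

variable {x}

/-- The domain `⋂ i, D(s i)` of the chart, an open subset of the spectrum of `R_M`. -/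
def Chart.domain (s : Chart x) : Set (CentralPrime x) :=
  {𝔭 | ∀ i, ¬ 𝔭.carrier (s.sec i)}

/-- The tt-ideal of `K` generated by the cones of the sections `s i`. -/
def Chart.ideal (s : Chart x) : ThickIdeal K :=
  ThickIdeal.generatedBy fun c => ∃ (i : ι) (f : (x i)⟦s.deg i⟧ ⟶ c) (g : c ⟶ (𝟙_ K)⟦(1 : ℤ)⟧),
    Triangle.mk (s.sec i) f g ∈ distTriang K

/-- The degree `d` part of the graded ring of the chart, which is the graded endomorphism ring
`Hom(Σᵈ 𝟙, 𝟙)` of the unit of the tt-category `K[s⁻¹] = K / ⟨cone (s i)⟩`. The domain of the chart is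
identified with the homogeneous spectrum of this graded ring. -/
abbrev Chart.ring (s : Chart x) : ℤ → Type _ := GEnd s.ideal.unit

/-- The homogeneous ideal of the ring of the chart which corresponds to a point `𝔭` of the domain: it
is the extension of `𝔭` along `R_M ⟶ K[s⁻¹]`, generated by the fractions `b ∘ t⁻¹ : Σᵈ 𝟙 ⟶ 𝟙` with
`b` in `𝔭` and with a morphism `t` of `R_M` which becomes invertible in `K[s⁻¹]`. -/
def Chart.primeAt (s : Chart x) (𝔭 : CentralPrime x) : Ideal (Total s.ring) :=
  Ideal.span {r | ∃ (d : ℤ) (a : s.ideal.carrier.trW.Q.obj ((𝟙_ K)⟦d⟧) ⟶ s.ideal.unit)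
    (k : K) (t : k ⟶ (𝟙_ K)⟦d⟧) (b : k ⟶ 𝟙_ K),
      centralRing x t ∧ s.ideal.carrier.trW t ∧ 𝔭.carrier b ∧
      s.ideal.carrier.trW.Q.map t ≫ a = s.ideal.carrier.trW.Q.map b ∧
      r = hom (A := s.ring)
        ((s.ideal.carrier.trW.Q.commShiftIso d).inv.app (𝟙_ K) ≫ a)}

/-- The period at a point `𝔭` of the chart, that is, the period of the local graded ring of `P{x i}` at
`𝔭`, computed in the chart. -/
def Chart.periodAt (s : Chart x) (𝔭 : CentralPrime x) : ℕ := ringPeriodAt (s.primeAt 𝔭)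

variable (x)

/-- The points of the graded scheme `P{x i}`: the union of the domains of all charts. -/
def gradedSchemeP : Set (CentralPrime x) := ⋃ s : Chart x, s.domain

end Family
end Spectrum
end TTPeriod

end

open TTPeriod

/-! Both parts come from one comparison. In `K / P` a tensor product vanishes only if a factor does.
If `a + b = 1` in the endomorphisms of the unit, then `a²` kills the cone `A` of `a` and `b²` kills
the cone `B` of `b`. So `a` and `b` square to zero on `A ⊗ B` and sum to the identity there. This
forces `A ⊗ B = 0`, hence `a` or `b` is invertible. Thus isomorphisms between invertible objects of
`K / P` behave like units of a graded local ring, so the non-invertible morphisms form homogeneous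
primes, both in the central 2-ring and in graded endomorphism rings of units.

For the periods, write an isomorphism between `𝟙` and `Σᵈ 𝟙` in `K / P` as a fraction. Rigidity
makes every tt-ideal an intersection of primes, so ampleness puts the cone of the denominator in the
ideal generated by the cone of one section `s : 𝟙 ⟶ m`. Every object of that ideal is annihilated by
a section of some `w` in `M` which is invertible modulo the ideal. The denominator can therefore be
taken of the form `w' ⊗ Σᵈ 𝟙 ⟶ Σᵈ 𝟙` with `w'` inverse to `w`
(`IsConeOfSections.exists_denominator`, `IsAmple.exists_fraction`).

In a chart every `x i` becomes a shift of the unit, so `w'` becomes some `Σʲ 𝟙`. Numerator and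
denominator are then homogeneous of degrees `j + d` and `j` and lie outside the prime. Their
quotient is a unit of degree `d` of the local ring. Conversely, such a unit maps to an isomorphism
in `K / P`. This is `period_eq_ringPeriodAt`; part (1) applies it to the quotient functor of a
chart, part (2) to the identity functor and the empty family. -/

noncomputable section

set_option linter.unusedSectionVars false

namespace TTPeriod

/-! ### Sections acting on objects, and invertible objects -/

section SectionAction

variable {C : Type u} [Category.{v} C] [MonoidalCategory C]

/-- The natural morphism `X ⟶ m ⊗ X` given by a section `s` of `m`. -/
def act {m : C} (s : 𝟙_ C ⟶ m) (X : C) : X ⟶ m ⊗ X := (λ_ X).inv ≫ s ▷ X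

theorem act_naturality {m : C} (s : 𝟙_ C ⟶ m) {X Y : C} (f : X ⟶ Y) :
    act s X ≫ m ◁ f = f ≫ act s Y := by
  simp [act, ← whisker_exchange]

theorem act_naturality_assoc {m : C} (s : 𝟙_ C ⟶ m) {X Y Z : C} (f : X ⟶ Y) (h : m ⊗ Y ⟶ Z) :
    act s X ≫ m ◁ f ≫ h = f ≫ act s Y ≫ h := by
  rw [← Category.assoc, act_naturality, Category.assoc]

theorem act_tensor {m : C} (s : 𝟙_ C ⟶ m) (X Y : C) :
    act s (X ⊗ Y) = act s X ▷ Y ≫ (α_ m X Y).hom := by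
  simp [act]

theorem act_unit {m : C} (s : 𝟙_ C ⟶ m) : act s (𝟙_ C) = s ≫ (ρ_ m).inv := by
  simp [act, unitors_inv_equal]

theorem act_tensor_section {m n : C} (s : 𝟙_ C ⟶ m) (t : 𝟙_ C ⟶ n) (X : C) :
    act (t ≫ act s n) X = act t X ≫ act s (n ⊗ X) ≫ (α_ m n X).inv := by
  simp [act]

/-- The action of the endomorphisms of the unit on an object. -/
def scalar (e : 𝟙_ C ⟶ 𝟙_ C) (X : C) : X ⟶ X := act e X ≫ (λ_ X).hom

theorem scalar_naturality (e : 𝟙_ C ⟶ 𝟙_ C) {X Y : C} (f : X ⟶ Y) :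
    scalar e X ≫ f = f ≫ scalar e Y := by
  simp [scalar, ← act_naturality_assoc]

theorem scalar_naturality_assoc (e : 𝟙_ C ⟶ 𝟙_ C) {X Y Z : C} (f : X ⟶ Y) (h : Y ⟶ Z) :
    scalar e X ≫ f ≫ h = f ≫ scalar e Y ≫ h := by
  rw [← Category.assoc, scalar_naturality, Category.assoc]

theorem scalar_id (X : C) : scalar (𝟙 (𝟙_ C)) X = 𝟙 X := by
  simp [scalar, act]

theorem scalar_tensor (e : 𝟙_ C ⟶ 𝟙_ C) (X Y : C) :
    scalar e (X ⊗ Y) = scalar e X ▷ Y := by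
  simp [scalar, act]

theorem scalar_add [Preadditive C] [MonoidalPreadditive C] (a b : 𝟙_ C ⟶ 𝟙_ C) (X : C) :
    scalar (a + b) X = scalar a X + scalar b X := by
  simp [scalar, act]

/-- An object with a tensor inverse. -/
def IsInvertible (u : C) : Prop := ∃ u' : C, Nonempty (u ⊗ u' ≅ 𝟙_ C)

theorem IsInvertible.unit : IsInvertible (𝟙_ C) := ⟨𝟙_ C, ⟨λ_ _⟩⟩

theorem IsInvertible.of_iso {u w : C} (e : u ≅ w) (h : IsInvertible u) : IsInvertible w := by
  obtain ⟨u', ⟨i⟩⟩ := h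
  exact ⟨u', ⟨(whiskerRightIso e u').symm ≪≫ i⟩⟩

theorem IsInvertible.tensor {u w : C} (hu : IsInvertible u) (hw : IsInvertible w) :
    IsInvertible (u ⊗ w) := by
  obtain ⟨u', ⟨i⟩⟩ := hu
  obtain ⟨w', ⟨j⟩⟩ := hw
  exact ⟨w' ⊗ u', ⟨α_ _ _ _ ≪≫ whiskerLeftIso u ((α_ _ _ _).symm ≪≫ whiskerRightIso j u' ≪≫
    λ_ _) ≪≫ i⟩⟩

variable [BraidedCategory C]

theorem IsInvertible.isEquivalence_tensorRight {u : C} (hu : IsInvertible u) :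
    (tensorRight u).IsEquivalence := by
  obtain ⟨u', ⟨i⟩⟩ := hu
  exact Functor.IsEquivalence.mk' (F := tensorRight u) (tensorRight u')
    (NatIso.ofComponents (fun X => (ρ_ X).symm ≪≫ whiskerLeftIso X i.symm ≪≫ (α_ X u u').symm)
      (fun {X Y} f => by
        dsimp
        simp only [Category.assoc]
        rw [rightUnitor_inv_naturality_assoc, ← associator_inv_naturality_left]
        simp only [whiskerLeftIso_hom, ← whisker_exchange_assoc]))
    (NatIso.ofComponents
      (fun X => α_ X u' u ≪≫ whiskerLeftIso X (β_ u' u ≪≫ i) ≪≫ ρ_ X)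
      (fun {X Y} f => by
        dsimp
        simp only [Category.assoc]
        rw [associator_naturality_left_assoc, ← rightUnitor_naturality]
        simp only [whiskerLeftIso_hom, ← whisker_exchange_assoc]))

theorem IsInvertible.whiskerRight_injective {u : C} (hu : IsInvertible u) {X Y : C}
    {f g : X ⟶ Y} (h : f ▷ u = g ▷ u) : f = g := by
  have := hu.isEquivalence_tensorRight
  exact (tensorRight u).map_injective h

/-- Tensoring with `u` is an equivalence, hence full, so an endomorphism of `𝟙 ⊗ u` comes from one
of `𝟙`. Scalars are natural, so every endomorphism of `u` slides past other morphisms. -/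
theorem IsInvertible.exists_scalar {u : C} (hu : IsInvertible u) (h : u ⟶ u) :
    ∃ e : 𝟙_ C ⟶ 𝟙_ C, scalar e u = h := by
  have := hu.isEquivalence_tensorRight
  obtain ⟨e, he⟩ := (tensorRight u).map_surjective
    (show (tensorRight u).obj (𝟙_ C) ⟶ (tensorRight u).obj (𝟙_ C) from
      (λ_ u).hom ≫ h ≫ (λ_ u).inv)
  refine ⟨e, ?_⟩
  have he' : e ▷ u = (λ_ u).hom ≫ h ≫ (λ_ u).inv := he
  simp [scalar, act, he']

theorem IsInvertible.eq_id_of_scalar_eq_id {u : C} (hu : IsInvertible u) {e : 𝟙_ C ⟶ 𝟙_ C}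
    (h : scalar e u = 𝟙 u) : e = 𝟙 _ := by
  apply hu.whiskerRight_injective
  have : e ▷ u = (λ_ u).hom ≫ scalar e u ≫ (λ_ u).inv := by simp [scalar, act]
  simp [this, h]

/-- A split epimorphism between invertible objects is an isomorphism. -/
theorem IsInvertible.comp_eq_id {u w : C} (hu : IsInvertible u) (hw : IsInvertible w)
    {f : u ⟶ w} {g : w ⟶ u} (h : g ≫ f = 𝟙 w) : f ≫ g = 𝟙 u := by
  obtain ⟨e, he⟩ := hu.exists_scalar (f ≫ g)
  have h₁ : scalar e w ≫ g = g := by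
    rw [scalar_naturality, he, reassoc_of% h]
  have h₂ : scalar e w = 𝟙 w := by
    simpa [h] using congrArg (· ≫ f) h₁
  rw [← he, hw.eq_id_of_scalar_eq_id h₂, scalar_id]

/-- An invertible composite splits `f` on one side and `g` on the other; between invertible objects
one-sided inverses are two-sided. -/
theorem IsInvertible.isIso_of_comp {u w z : C} (hu : IsInvertible u) (hw : IsInvertible w)
    (hz : IsInvertible z) (f : u ⟶ w) (g : w ⟶ z) [IsIso (f ≫ g)] : IsIso f ∧ IsIso g := by
  have hg : (inv (f ≫ g) ≫ f) ≫ g = 𝟙 z := by simp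
  have hf : f ≫ g ≫ inv (f ≫ g) = 𝟙 u := by rw [← Category.assoc]; exact IsIso.hom_inv_id _
  exact ⟨⟨_, hf, hw.comp_eq_id hu hf⟩, ⟨_, hw.comp_eq_id hz hg, hg⟩⟩

/-- Two orders of tensoring with a section differ by a scalar on `m ⊗ m`. -/
theorem IsInvertible.act_comp_eq_zero [Preadditive C] [MonoidalPreadditive C] {m Z : C}
    (hm : IsInvertible m) (s : 𝟙_ C ⟶ m) (g : m ⟶ Z) (h : s ≫ g = 0) : g ≫ act s Z = 0 := by
  obtain ⟨e, he⟩ := (hm.tensor hm).exists_scalar (β_ m m).hom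
  have h₁ : act s m = (ρ_ m).inv ≫ m ◁ s ≫ (β_ m m).hom := by
    simp [act]
  -- The braiding of `m ⊗ m` is a scalar, so it moves past `m ◁ g` and leaves the factor `m ◁ (s ≫
  -- g) = 0`.
  rw [← act_naturality, h₁, ← he]
  simp only [Category.assoc, scalar_naturality]
  rw [← MonoidalCategory.whiskerLeft_comp_assoc, h]
  simp

end SectionAction

/-! ### Nilpotence on cones, and locality of the endomorphisms of the unit -/

section Cones

variable {C : Type u} [Category.{v} C] [HasZeroObject C] [HasShift C ℤ] [Preadditive C]
  [∀ n : ℤ, (shiftFunctor C n).Additive] [Pretriangulated C] [MonoidalCategory C]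

/-- If the suspension is tensoring with an object, and `s` vanishes on `m` after mapping to its
cone `Z`, then `s ⊗ s` vanishes on `Z`. -/
theorem act_comp_act_cone {S : C} (Φ : tensorRight S ≅ shiftFunctor C (1 : ℤ)) {m Z : C}
    {s : 𝟙_ C ⟶ m} {g : m ⟶ Z} {δ : Z ⟶ (𝟙_ C)⟦(1 : ℤ)⟧}
    (hT : Triangle.mk s g δ ∈ distTriang C) (hg : g ≫ act s Z = 0)
    [∀ X : C, (tensorLeft X).PreservesZeroMorphisms] :
    act s Z ≫ act s (m ⊗ Z) = 0 := by
  obtain ⟨h, hh⟩ : ∃ h : (𝟙_ C)⟦(1 : ℤ)⟧ ⟶ m ⊗ Z, act s Z = δ ≫ h :=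
    Triangle.yoneda_exact₃ _ hT (act s Z) hg
  have hδ : δ ≫ s⟦(1 : ℤ)⟧' = 0 := comp_distTriang_mor_zero₃₁ _ hT
  have h₁ : Φ.inv.app (𝟙_ C) ≫ act s (𝟙_ C ⊗ S) =
      act s ((𝟙_ C)⟦(1 : ℤ)⟧) ≫ m ◁ Φ.inv.app (𝟙_ C) :=
    (act_naturality s (Φ.inv.app (𝟙_ C))).symm
  have h₂ : (act s (𝟙_ C))⟦(1 : ℤ)⟧' ≫ Φ.inv.app _ = Φ.inv.app (𝟙_ C) ≫ act s (𝟙_ C) ▷ S :=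
    Φ.inv.naturality (act s (𝟙_ C))
  -- Through `Φ`, the action of `s` on `Σ 𝟙` is `Σ s` up to isomorphism, and `δ ≫ Σ s = 0` in the
  -- triangle. Since `act s Z` factors through `δ`, naturality then makes the second action vanish.
  have h₃ : δ ≫ act s ((𝟙_ C)⟦(1 : ℤ)⟧) = 0 := by
    have : IsIso (m ◁ Φ.inv.app (𝟙_ C)) := inferInstance
    rw [← cancel_mono (m ◁ Φ.inv.app (𝟙_ C)), Category.assoc, ← h₁, act_tensor,
      ← reassoc_of% h₂, act_unit, Functor.map_comp, Category.assoc, reassoc_of% hδ]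
    simp
  rw [hh, Category.assoc, ← act_naturality, reassoc_of% h₃, zero_comp]

variable [BraidedCategory C] [MonoidalPreadditive C]

theorem scalar_sq_cone {S : C} (Φ : tensorRight S ≅ shiftFunctor C (1 : ℤ)) {Z : C}
    {a : 𝟙_ C ⟶ 𝟙_ C} {g : 𝟙_ C ⟶ Z} {δ : Z ⟶ (𝟙_ C)⟦(1 : ℤ)⟧}
    (hT : Triangle.mk a g δ ∈ distTriang C) : scalar a Z ≫ scalar a Z = 0 := by
  have h := act_comp_act_cone Φ hT
    (IsInvertible.unit.act_comp_eq_zero _ _ (comp_distTriang_mor_zero₁₂ _ hT))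
  have h' : (λ_ Z).hom ≫ act a Z = act a (𝟙_ C ⊗ Z) ≫ 𝟙_ C ◁ (λ_ Z).hom :=
    (act_naturality a _).symm
  simp only [scalar, Category.assoc]
  rw [reassoc_of% h', reassoc_of% h, zero_comp]

/-- If the tensor product has no zero divisors, the endomorphism ring of the unit is local. -/
theorem isIso_or_isIso_of_add_eq_id {S : C} (Φ : tensorRight S ≅ shiftFunctor C (1 : ℤ))
    (hC : ∀ X Y : C, IsZero (X ⊗ Y) → IsZero X ∨ IsZero Y) {a b : 𝟙_ C ⟶ 𝟙_ C}
    (hab : a + b = 𝟙 _) : IsIso a ∨ IsIso b := by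
  obtain ⟨A, g, δ, hA⟩ := distinguished_cocone_triangle a
  obtain ⟨B, g', δ', hB⟩ := distinguished_cocone_triangle b
  have ha : scalar a (A ⊗ B) ≫ scalar a (A ⊗ B) = 0 := by
    rw [scalar_tensor, ← MonoidalCategory.comp_whiskerRight, scalar_sq_cone Φ hA]
    simp
  have hb : scalar b (A ⊗ B) ≫ scalar b (A ⊗ B) = 0 := by
    rw [← cancel_epi (β_ B A).hom, ← scalar_naturality_assoc, ← scalar_naturality,
      scalar_tensor, ← MonoidalCategory.comp_whiskerRight_assoc, scalar_sq_cone Φ hB]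
    simp
  have hs : scalar a (A ⊗ B) + scalar b (A ⊗ B) = 𝟙 _ := by
    rw [← scalar_add, hab, scalar_id]
  -- With `p + q = 1` and `p² = q² = 0`, expanding `(1 - p)² = 0` gives `1 = 2p`. Multiplying by `p`
  -- gives `p = 0`, hence `1 = 0`; no division by `2` is needed.
  have h0 : IsZero (A ⊗ B) := by
    rw [IsZero.iff_id_eq_zero]
    have e₁ : scalar b (A ⊗ B) = 𝟙 _ - scalar a (A ⊗ B) := eq_sub_of_add_eq' hs
    rw [e₁] at hb
    have e₂ : 𝟙 (A ⊗ B) = scalar a (A ⊗ B) + scalar a (A ⊗ B) := by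
      simp only [Preadditive.comp_sub, Preadditive.sub_comp, ha, Category.id_comp,
        Category.comp_id] at hb
      rw [sub_zero, sub_sub, sub_eq_zero] at hb
      exact hb
    have e₃ : scalar a (A ⊗ B) = 0 := by
      have := congrArg (scalar a (A ⊗ B) ≫ ·) e₂
      simpa [ha] using this
    rw [e₂, e₃, add_zero]
  rcases hC _ _ h0 with h | h
  · exact Or.inl ((Triangle.isZero₃_iff_isIso₁ _ hA).1 h)
  · exact Or.inr ((Triangle.isZero₃_iff_isIso₁ _ hB).1 h)

/-- Composing with the inverse of `a + b` gives two endomorphisms of `u` with sum `1`; both are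
scalars, which reduces to the unit. -/
theorem IsInvertible.isIso_or_isIso_of_add {S : C} (Φ : tensorRight S ≅ shiftFunctor C (1 : ℤ))
    (hC : ∀ X Y : C, IsZero (X ⊗ Y) → IsZero X ∨ IsZero Y) {u w : C} (hu : IsInvertible u)
    (a b : u ⟶ w) (hab : IsIso (a + b)) : IsIso a ∨ IsIso b := by
  obtain ⟨e, he⟩ := hu.exists_scalar (a ≫ inv (a + b))
  obtain ⟨f, hf⟩ := hu.exists_scalar (b ≫ inv (a + b))
  have hef : e + f = 𝟙 _ := by
    refine hu.eq_id_of_scalar_eq_id ?_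
    rw [scalar_add, he, hf, ← Preadditive.add_comp, IsIso.hom_inv_id]
  have key : ∀ (c : u ⟶ w) (e : 𝟙_ C ⟶ 𝟙_ C) (_ : scalar e u = c ≫ inv (a + b)) (_ : IsIso e),
      IsIso c := by
    intro c e he _
    have : IsIso (scalar e u) := by
      unfold scalar act
      infer_instance
    rw [he] at this
    exact IsIso.of_isIso_comp_right c (inv (a + b))
  exact (isIso_or_isIso_of_add_eq_id Φ hC hef).imp (key a e he) (key b f hf)

end Cones

/-! ### tt-ideals, existence of primes, and denominators given by sections -/

section TensorTriangulated

variable {K : Type u} [Category.{v} K] [HasZeroObject K] [HasShift K ℤ]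
  [Preadditive K] [∀ n : ℤ, (shiftFunctor K n).Additive] [Pretriangulated K]
  [MonoidalCategory K] [SymmetricCategory K] [TensorTriangulated K]

instance TensorTriangulated.monoidalPreadditive : MonoidalPreadditive K where
  whiskerLeft_zero {X _ _} := (tensorLeft X).map_zero _ _
  zero_whiskerRight {X Y Z} := by
    have h : X ◁ (0 : Y ⟶ Z) = 0 := (tensorLeft X).map_zero _ _
    rw [← cancel_mono (β_ Z X).hom, BraidedCategory.braiding_naturality_left, h]
    simp
  whiskerLeft_add {X _ _} _ _ := (tensorLeft X).map_add
  add_whiskerRight {X Y Z} f g := by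
    have h : X ◁ (f + g) = X ◁ f + X ◁ g := (tensorLeft X).map_add
    rw [← cancel_mono (β_ Z X).hom, BraidedCategory.braiding_naturality_left, h]
    simp

/-- Tensoring with a suspension of the unit is suspending. -/
def tensorRightShiftUnit (d : ℤ) : tensorRight ((𝟙_ K)⟦d⟧) ≅ shiftFunctor K d :=
  NatIso.ofComponents
    (fun a => ((tensorLeft a).commShiftIso d).app (𝟙_ K) ≪≫ (shiftFunctor K d).mapIso (ρ_ a))
    (fun {a b} f => by
      have h := TensorTriangulated.natural f (𝟙_ K) d
      dsimp at h ⊢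
      rw [reassoc_of% h, Category.assoc, ← Functor.map_comp, ← Functor.map_comp,
        MonoidalCategory.rightUnitor_naturality])

theorem IsInvertible.shift {u : K} (hu : IsInvertible u) (d : ℤ) : IsInvertible (u⟦d⟧) := by
  have h : IsInvertible ((𝟙_ K)⟦d⟧) :=
    ⟨(𝟙_ K)⟦-d⟧, ⟨(tensorRightShiftUnit (-d)).app _ ≪≫ (shiftEquiv K d).unitIso.symm.app _⟩⟩
  exact (hu.tensor h).of_iso ((tensorRightShiftUnit d).app u)

instance ThickIdeal.isMonoidal_trW (I : ThickIdeal K) : I.carrier.trW.IsMonoidal where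
  whiskerLeft X Y₁ Y₂ g hg := by
    obtain ⟨Z, a, b, hT, hZ⟩ := hg
    exact ObjectProperty.trW.mk I.carrier ((tensorLeft X).map_distinguished _ hT)
      (I.tensor_mem X Z hZ)
  whiskerRight {X₁ X₂} f hf Y := by
    have : I.carrier.trW (Y ◁ f) := by
      obtain ⟨Z, a, b, hT, hZ⟩ := hf
      exact ObjectProperty.trW.mk I.carrier ((tensorLeft Y).map_distinguished _ hT)
        (I.tensor_mem Y Z hZ)
    exact (I.carrier.trW.arrow_mk_iso_iff (Arrow.isoMk (β_ X₁ Y) (β_ X₂ Y) (by simp))).2 this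

theorem ThickIdeal.trW_act (I : ThickIdeal K) {m : K} {s : 𝟙_ K ⟶ m} (hs : I.carrier.trW s)
    (X : K) : I.carrier.trW (act s X) :=
  MorphismProperty.RespectsIso.precomp _ _ _ (I.carrier.trW.whiskerRight_mem s hs X)

/-- The tt-ideal of the objects `x` with `b ⊗ x` in `I`. -/
def ThickIdeal.colon (I : ThickIdeal K) (b : K) : ThickIdeal K where
  carrier := I.carrier.inverseImage (tensorLeft b)
  isTriangulated := inferInstance
  isClosedUnderIsomorphisms := inferInstance
  isStableUnderRetracts := ⟨fun r h => I.carrier.prop_of_retract (r.map (tensorLeft b)) h⟩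
  tensor_mem a x h := I.carrier.prop_of_iso
    ((α_ _ _ _).symm ≪≫ whiskerRightIso (β_ a b) x ≪≫ α_ _ _ _) (I.tensor_mem a _ h)

/-- A dual `d` makes `c` a retract of `c ⊗ d ⊗ c` by a triangle identity. Hence tt-ideals are
radical. -/
theorem ThickIdeal.mem_of_tensor_self_mem (hK : IsRigid K) (I : ThickIdeal K) {c : K}
    (h : I.carrier (c ⊗ c)) : I.carrier c := by
  obtain ⟨d, ⟨_⟩⟩ := hK c
  have hr : Retract c ((c ⊗ d) ⊗ c) :=
    { i := (λ_ c).inv ≫ η_ c d ▷ c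
      r := (α_ c d c).hom ≫ c ◁ ε_ c d ≫ (ρ_ c).hom
      retract := by
        have := ExactPairing.evaluation_coevaluation c d
        simp [reassoc_of% this] }
  refine I.carrier.prop_of_retract hr (I.carrier.prop_of_iso ?_ (I.tensor_mem d _ h))
  exact (α_ _ _ _).symm ≪≫ whiskerRightIso (β_ d c) c

/-- Union of a chain of tt-ideals. -/
def ThickIdeal.chainUnion (c : Set (ObjectProperty K)) (hc : IsChain (· ≤ ·) c)
    (hne : c.Nonempty) (h : ∀ p ∈ c, ∃ I : ThickIdeal K, I.carrier = p) : ThickIdeal K where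
  carrier X := ∃ p ∈ c, p X
  isTriangulated :=
    { exists_zero := by
        obtain ⟨p, hp⟩ := hne
        obtain ⟨I, rfl⟩ := h p hp
        exact ⟨_, isZero_zero K, _, hp, I.carrier.prop_zero⟩
      isStableUnderShiftBy := fun n => ⟨by
        rintro X ⟨p, hp, hX⟩
        obtain ⟨I, rfl⟩ := h p hp
        exact ⟨_, hp, I.carrier.le_shift n _ hX⟩⟩
      ext₂' := by
        rintro T hT ⟨p, hp, h₁⟩ ⟨q, hq, h₃⟩
        refine ObjectProperty.le_isoClosure _ _ ?_
        obtain hpq | hpq := hc.total hp hq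
        · obtain ⟨I, rfl⟩ := h q hq
          exact ⟨_, hq, I.carrier.ext_of_isTriangulatedClosed₂ T hT (hpq _ h₁) h₃⟩
        · obtain ⟨I, rfl⟩ := h p hp
          exact ⟨_, hp, I.carrier.ext_of_isTriangulatedClosed₂ T hT h₁ (hpq _ h₃)⟩ }
  isClosedUnderIsomorphisms := ⟨by
    rintro X Y e ⟨p, hp, hX⟩
    obtain ⟨I, rfl⟩ := h p hp
    exact ⟨_, hp, I.carrier.prop_of_iso e hX⟩⟩
  isStableUnderRetracts := ⟨by
    rintro X Y e ⟨p, hp, hX⟩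
    obtain ⟨I, rfl⟩ := h p hp
    exact ⟨_, hp, I.carrier.prop_of_retract e hX⟩⟩
  tensor_mem := by
    rintro a X ⟨p, hp, hX⟩
    obtain ⟨I, rfl⟩ := h p hp
    exact ⟨_, hp, I.tensor_mem a X hX⟩

/-- By Zorn there is an ideal maximal among those that contain `J` and avoid `c`. It is prime
because tt-ideals are radical. -/
theorem ThickIdeal.exists_prime (hK : IsRigid K) (J : ThickIdeal K) {c : K}
    (hc : ¬ J.carrier c) : ∃ P : Spectrum K, J.carrier ≤ P.carrier ∧ ¬ P.carrier c := by
  let S : Set (ObjectProperty K) := {p | (∃ I : ThickIdeal K, I.carrier = p) ∧ ¬ p c}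
  obtain ⟨p, hJp, hp⟩ := zorn_le_nonempty₀ S (fun C hCS hC y hy => by
    refine ⟨(ThickIdeal.chainUnion C hC ⟨y, hy⟩ fun p hp => (hCS hp).1).carrier, ⟨⟨_, rfl⟩, ?_⟩,
      fun q hq X hX => ⟨q, hq, hX⟩⟩
    rintro ⟨q, hq, h⟩
    exact (hCS hq).2 h) J.carrier ⟨⟨J, rfl⟩, hc⟩
  obtain ⟨⟨⟨I, rfl⟩, hcI⟩, hmax⟩ := hp
  -- The colon ideal `(I : b)` contains `I`, and also `a`, so by maximality it contains `c`. Using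
  -- this for both factors leads to `c ⊗ c` in `I`.
  have key : ∀ a b : K, I.carrier (b ⊗ a) → ¬ I.carrier a → I.carrier (b ⊗ c) := by
    intro a b hab ha
    by_contra hbc
    exact ha (hmax (y := (I.colon b).carrier) ⟨⟨_, rfl⟩, hbc⟩ (fun x hx => I.tensor_mem b x hx) _ hab)
  refine ⟨{ I with
    unit_notMem := fun h => hcI (I.carrier.prop_of_iso (ρ_ c) (I.tensor_mem c _ h))
    mem_or_mem := fun a b hab => ?_ }, hJp, hcI⟩
  by_contra! hn
  have h₁ := key b a hab hn.2
  have h₂ := key a c (I.carrier.prop_of_iso (β_ a c) h₁) hn.1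
  exact hcI (I.mem_of_tensor_self_mem hK h₂)

variable {ι : Type} {x : ι → K}

theorem PicMonoid.unit : PicMonoid x (𝟙_ K) :=
  (PicMonoid.shift 0).iso ((shiftFunctorZero K ℤ).app _)

theorem PicMonoid.shift_mem {m : K} (hm : PicMonoid x m) (d : ℤ) : PicMonoid x (m⟦d⟧) :=
  (hm.tensor (PicMonoid.shift d)).iso ((tensorRightShiftUnit d).app m)

theorem PicMonoid.isInvertible (hx : ∀ i, IsInvertible (x i)) {m : K} (hm : PicMonoid x m) :
    IsInvertible m := by
  induction hm with
  | of i => exact hx i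
  | shift d => exact IsInvertible.unit.shift d
  | tensor _ _ h₁ h₂ => exact h₁.tensor h₂
  | iso e _ h => exact h.of_iso e

theorem act_eq_zero_of_tensor {m X Y : K} {s : 𝟙_ K ⟶ m} (h : act s X = 0) :
    act s (X ⊗ Y) = 0 := by
  rw [act_tensor, h]; simp

theorem act_eq_zero_of_retract {m X Y : K} {s : 𝟙_ K ⟶ m} (r : Retract X Y)
    (h : act s Y = 0) : act s X = 0 := by
  have : act s X = r.i ≫ act s Y ≫ m ◁ r.r := by
    rw [act_naturality, r.retract_assoc]
  rw [this, h]; simp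

theorem act_eq_zero_of_iso {m X Y : K} {s : 𝟙_ K ⟶ m} (e : X ≅ Y)
    (h : act s X = 0) : act s Y = 0 :=
  act_eq_zero_of_retract e.symm.retract h

variable (x) in
/-- The tt-ideal of the objects which are annihilated by a section, of an object of the monoid
generated by the family, which is invertible modulo `I`. -/
def ThickIdeal.killed (I : ThickIdeal K) : ThickIdeal K where
  carrier X := ∃ (m : K) (s : 𝟙_ K ⟶ m), PicMonoid x m ∧ I.carrier.trW s ∧ act s X = 0
  isTriangulated :=
    { exists_zero := ⟨_, isZero_zero K, 𝟙_ K, 𝟙 _, PicMonoid.unit, MorphismProperty.id_mem _ _,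
        (isZero_zero K).eq_of_src _ _⟩
      isStableUnderShiftBy := fun n => ⟨by
        rintro X ⟨m, s, hm, hs, h⟩
        exact ⟨m, s, hm, hs, act_eq_zero_of_iso ((tensorRightShiftUnit n).app X)
          (act_eq_zero_of_tensor h)⟩⟩
      ext₂' := by
        rintro T hT ⟨m, s, hm, hs, h₁⟩ ⟨n, t, hn, ht, h₃⟩
        refine ObjectProperty.le_isoClosure _ _ ⟨m ⊗ n, t ≫ act s n, hm.tensor hn,
          MorphismProperty.comp_mem _ _ _ ht (I.trW_act hs n), ?_⟩
        -- Since `t` kills the third object, its action on the middle one factors through `n ⊗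
        -- T.obj₁`, which `s` kills. So the product of the two sections kills the middle object.
        have e₁ : act t T.obj₂ ≫ n ◁ T.mor₂ = 0 := by
          rw [act_naturality, h₃, comp_zero]
        obtain ⟨y, hy⟩ : ∃ y : T.obj₂ ⟶ n ⊗ T.obj₁, act t T.obj₂ = y ≫ n ◁ T.mor₁ :=
          Triangle.coyoneda_exact₂ _ ((tensorLeft n).map_distinguished _ hT) (act t T.obj₂) e₁
        have e₂ : act s (n ⊗ T.obj₁) = 0 :=
          act_eq_zero_of_iso (β_ _ _) (act_eq_zero_of_tensor h₁)
        rw [act_tensor_section, hy, Category.assoc, ← act_naturality_assoc, reassoc_of% e₂]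
        simp }
  isClosedUnderIsomorphisms := ⟨by
    rintro X Y e ⟨m, s, hm, hs, h⟩
    exact ⟨m, s, hm, hs, act_eq_zero_of_iso e h⟩⟩
  isStableUnderRetracts := ⟨by
    rintro X Y e ⟨m, s, hm, hs, h⟩
    exact ⟨m, s, hm, hs, act_eq_zero_of_retract e h⟩⟩
  tensor_mem := by
    rintro a X ⟨m, s, hm, hs, h⟩
    exact ⟨m, s, hm, hs, act_eq_zero_of_iso (β_ _ _) (act_eq_zero_of_tensor h)⟩

variable (x) in
/-- `S` consists of cones of sections of objects of the monoid generated by the family. -/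
def IsConeOfSections (S : ObjectProperty K) : Prop :=
  ∀ c, S c → ∃ (m : K) (s : 𝟙_ K ⟶ m) (f : m ⟶ c) (g : c ⟶ (𝟙_ K)⟦(1 : ℤ)⟧),
    PicMonoid x m ∧ Triangle.mk s f g ∈ distTriang K

theorem ThickIdeal.subset_generatedBy {S : ObjectProperty K} :
    S ≤ (ThickIdeal.generatedBy S).carrier :=
  fun c hc _ hI => hI c hc

theorem ThickIdeal.generatedBy_le {S : ObjectProperty K} {I : ThickIdeal K} (h : S ≤ I.carrier) :
    (ThickIdeal.generatedBy S).carrier ≤ I.carrier :=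
  fun _ hc => hc I h

/-- The killed objects form a tt-ideal, so it suffices to treat a generator, the cone of a section
`s`; it is killed by `s ⊗ s`. -/
theorem IsConeOfSections.le_killed (hx : ∀ i, IsInvertible (x i)) {S : ObjectProperty K}
    (hS : IsConeOfSections x S) :
    (ThickIdeal.generatedBy S).carrier ≤ ((ThickIdeal.generatedBy S).killed x).carrier := by
  refine ThickIdeal.generatedBy_le fun c hc => ?_
  obtain ⟨m, s, f, g, hm, hT⟩ := hS c hc
  have hs : (ThickIdeal.generatedBy S).carrier.trW s :=
    ⟨_, _, _, hT, ThickIdeal.subset_generatedBy c hc⟩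
  refine ⟨m ⊗ m, s ≫ act s m, hm.tensor hm,
    MorphismProperty.comp_mem _ _ _ hs (ThickIdeal.trW_act _ hs m), ?_⟩
  rw [act_tensor_section, reassoc_of% (act_comp_act_cone (tensorRightShiftUnit 1) hT
    ((hm.isInvertible hx).act_comp_eq_zero _ _ (comp_distTriang_mor_zero₁₂ _ hT)))]
  simp

/-- Denominators modulo an ideal generated by cones of sections can be chosen to be of the form
`w' ⊗ a ⟶ a`, where `w'` is inverse to an object of the monoid generated by the family. -/
theorem IsConeOfSections.exists_denominator (hx : ∀ i, IsInvertible (x i)) {S : ObjectProperty K}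
    (hS : IsConeOfSections x S) {a c : K} (t : c ⟶ a)
    (ht : (ThickIdeal.generatedBy S).carrier.trW t) :
    ∃ (w w' : K) (z : w' ⊗ a ⟶ c), PicMonoid x w ∧ Nonempty (w ⊗ w' ≅ 𝟙_ K) ∧
      (ThickIdeal.generatedBy S).carrier.trW (z ≫ t) := by
  obtain ⟨Z, g, δ, hT, hZ⟩ := ht
  obtain ⟨w, s, hw, hs, h⟩ := hS.le_killed hx _ hZ
  -- As `s` kills the cone of `t`, its action on `a` lifts along `w ◁ t`. Tensoring the lift with
  -- `w'` gives `z`, and `z ≫ t` is `w' ◁ act s a` up to isomorphism, hence invertible modulo the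
  -- ideal.
  have e₁ : act s a ≫ w ◁ g = 0 := by rw [act_naturality, h, comp_zero]
  obtain ⟨y, hy⟩ : ∃ y : a ⟶ w ⊗ c, act s a = y ≫ w ◁ t :=
    Triangle.coyoneda_exact₂ _ ((tensorLeft w).map_distinguished _ hT) (act s a) e₁
  obtain ⟨w', ⟨i⟩⟩ := hw.isInvertible hx
  let E : ∀ X : K, w' ⊗ (w ⊗ X) ≅ X := fun X =>
    (α_ _ _ _).symm ≪≫ whiskerRightIso (β_ w' w ≪≫ i) X ≪≫ λ_ X
  have hE : ∀ {X Y : K} (f : X ⟶ Y), (E X).hom ≫ f = w' ◁ (w ◁ f) ≫ (E Y).hom := by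
    intro X Y f
    simp only [E, Iso.trans_hom, Category.assoc, whiskerRightIso_hom, Iso.symm_hom,
      ← leftUnitor_naturality]
    rw [← whisker_exchange_assoc]
    simp
  refine ⟨w, w', w' ◁ y ≫ (E c).hom, hw, ⟨i⟩, ?_⟩
  rw [Category.assoc, hE, ← MonoidalCategory.whiskerLeft_comp_assoc, ← hy]
  exact MorphismProperty.RespectsIso.postcomp _ _ _
    ((ThickIdeal.generatedBy S).carrier.trW.whiskerLeft_mem w' _ (ThickIdeal.trW_act _ hs a))

end TensorTriangulated

/-! ### Verdier quotients by tt-ideals -/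

section Quotient

variable {K : Type u} [Category.{v} K] [HasZeroObject K] [HasShift K ℤ]
  [Preadditive K] [∀ n : ℤ, (shiftFunctor K n).Additive] [Pretriangulated K]
  [MonoidalCategory K] [IsTriangulated K]

/-- The Verdier quotient functor. -/
abbrev ThickIdeal.Q (I : ThickIdeal K) : K ⥤ I.Quotient := I.carrier.trW.Q

-- Thickness enters here: if `X` dies in the quotient, a zero morphism to `X` has its cone in `I`,
-- and `X` is a retract of that cone.
open scoped ZeroObject in
theorem ThickIdeal.isZero_Q_iff (I : ThickIdeal K) (X : K) :
    IsZero (I.Q.obj X) ↔ I.carrier X := by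
  constructor
  · intro h
    have h0 : I.Q.map (𝟙 X) = I.Q.map 0 := h.eq_of_src _ _
    obtain ⟨Z, s, hs, h⟩ := (MorphismProperty.map_eq_iff_precomp I.Q I.carrier.trW _ _).1 h0
    rw [Category.comp_id, comp_zero] at h
    subst h
    obtain ⟨C, g, δ, hT, hC⟩ := hs
    obtain ⟨r, hr⟩ : ∃ r : C ⟶ X, 𝟙 X = g ≫ r :=
      Triangle.yoneda_exact₂ _ hT (𝟙 X) zero_comp
    exact I.carrier.prop_of_retract ⟨g, r, hr.symm⟩ hC
  · intro h
    have : I.carrier.trW (0 : (0 : K) ⟶ X) :=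
      (I.carrier.trW_iff_of_distinguished _ (contractible_distinguished₁ X)).2 h
    have := Localization.inverts I.Q I.carrier.trW _ this
    exact (I.Q.map_isZero (isZero_zero K)).of_iso (asIso (I.Q.map (0 : (0 : K) ⟶ X))).symm

theorem ThickIdeal.isIso_Q_map_iff (I : ThickIdeal K) {X Y : K} (f : X ⟶ Y) :
    IsIso (I.Q.map f) ↔ I.carrier.trW f := by
  constructor
  · intro h
    obtain ⟨Z, g, δ, hT⟩ := distinguished_cocone_triangle f
    have := (Triangle.isZero₃_iff_isIso₁ _ (I.Q.map_distinguished _ hT)).2 h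
    exact ⟨Z, g, δ, hT, (I.isZero_Q_iff Z).1 this⟩
  · exact Localization.inverts I.Q I.carrier.trW f

theorem ThickIdeal.exists_fraction (I : ThickIdeal K) {X Y : K} (f : I.Q.obj X ⟶ I.Q.obj Y) :
    ∃ (c : K) (t : c ⟶ X) (b : c ⟶ Y), I.carrier.trW t ∧ I.Q.map t ≫ f = I.Q.map b := by
  obtain ⟨φ, rfl⟩ := Localization.exists_rightFraction I.Q I.carrier.trW f
  exact ⟨φ.X', φ.s, φ.f, φ.hs, φ.map_s_comp_map _ _⟩

end Quotient

/-! ### The tensor structure on Verdier quotients, and locality of `K / P` -/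

section QuotientMonoidal

variable {K : Type u} [Category.{v} K] [HasZeroObject K] [HasShift K ℤ]
  [Preadditive K] [∀ n : ℤ, (shiftFunctor K n).Additive] [Pretriangulated K]
  [MonoidalCategory K] [SymmetricCategory K] [TensorTriangulated K]

instance ThickIdeal.quotientMonoidal (I : ThickIdeal K) : MonoidalCategory I.Quotient :=
  inferInstanceAs (MonoidalCategory (LocalizedMonoidal I.carrier.trW.Q I.carrier.trW (Iso.refl _)))

instance ThickIdeal.quotientBraided (I : ThickIdeal K) : BraidedCategory I.Quotient :=
  inferInstanceAs (BraidedCategory (LocalizedMonoidal I.carrier.trW.Q I.carrier.trW (Iso.refl _)))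

instance ThickIdeal.monoidalQ (I : ThickIdeal K) : I.Q.Monoidal :=
  inferInstanceAs (Localization.Monoidal.toMonoidalCategory I.carrier.trW.Q I.carrier.trW
    (Iso.refl _)).Monoidal

/-- Tensoring with the image of an object, as a localized functor. -/
def ThickIdeal.tensorRightQ (I : ThickIdeal K) (X : K) :
    I.Q ⋙ tensorRight (I.Q.obj X) ≅ tensorRight X ⋙ I.Q :=
  NatIso.ofComponents (fun a => Functor.Monoidal.μIso I.Q a X) (fun f => by simp)

def ThickIdeal.tensorLeftQ (I : ThickIdeal K) (X : K) :
    I.Q ⋙ tensorLeft (I.Q.obj X) ≅ tensorLeft X ⋙ I.Q :=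
  NatIso.ofComponents (fun a => Functor.Monoidal.μIso I.Q X a) (fun f => by simp)

instance (X : K) : (tensorRight X).Additive := { map_add := by simp }

instance (X : K) : (tensorLeft X).Additive := { map_add := by simp }

theorem ThickIdeal.exists_iso_Q (I : ThickIdeal K) (X : I.Quotient) :
    ∃ Y : K, Nonempty (I.Q.obj Y ≅ X) :=
  have := Localization.essSurj I.Q I.carrier.trW
  ⟨_, ⟨I.Q.objObjPreimageIso X⟩⟩

theorem ThickIdeal.additive_tensorRight (I : ThickIdeal K) (X : I.Quotient) :
    (tensorRight X).Additive := by
  obtain ⟨Y, ⟨e⟩⟩ := I.exists_iso_Q X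
  have h : (tensorRight (I.Q.obj Y)).Additive := by
    rw [Localization.functor_additive_iff I.Q I.carrier.trW]
    exact Functor.additive_of_iso (I.tensorRightQ Y).symm
  exact Functor.additive_of_iso ((tensoringRight _).mapIso e)

theorem ThickIdeal.additive_tensorLeft (I : ThickIdeal K) (X : I.Quotient) :
    (tensorLeft X).Additive := by
  obtain ⟨Y, ⟨e⟩⟩ := I.exists_iso_Q X
  have h : (tensorLeft (I.Q.obj Y)).Additive := by
    rw [Localization.functor_additive_iff I.Q I.carrier.trW]
    exact Functor.additive_of_iso (I.tensorLeftQ Y).symm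
  exact Functor.additive_of_iso ((tensoringLeft _).mapIso e)

instance ThickIdeal.quotientMonoidalPreadditive (I : ThickIdeal K) :
    MonoidalPreadditive I.Quotient where
  whiskerLeft_zero {X _ _} := have := I.additive_tensorLeft X; (tensorLeft X).map_zero _ _
  zero_whiskerRight {X _ _} := have := I.additive_tensorRight X; (tensorRight X).map_zero _ _
  whiskerLeft_add {X _ _} _ _ := have := I.additive_tensorLeft X; (tensorLeft X).map_add
  add_whiskerRight {X _ _} _ _ := have := I.additive_tensorRight X; (tensorRight X).map_add

/-- Tensoring with the suspension of the unit is suspending, in the Verdier quotient. -/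
def ThickIdeal.quotientTensorRightShiftUnit (I : ThickIdeal K) :
    tensorRight (I.Q.obj ((𝟙_ K)⟦(1 : ℤ)⟧)) ≅ shiftFunctor I.Quotient (1 : ℤ) :=
  Localization.liftNatIso I.Q I.carrier.trW
    (I.Q ⋙ tensorRight (I.Q.obj ((𝟙_ K)⟦(1 : ℤ)⟧))) (I.Q ⋙ shiftFunctor I.Quotient (1 : ℤ)) _ _
    (I.tensorRightQ _ ≪≫ Functor.isoWhiskerRight (tensorRightShiftUnit 1) I.Q ≪≫
      I.Q.commShiftIso (1 : ℤ))

theorem IsInvertible.Q (I : ThickIdeal K) {u : K} (hu : IsInvertible u) :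
    IsInvertible (I.Q.obj u) := by
  obtain ⟨u', ⟨i⟩⟩ := hu
  exact ⟨I.Q.obj u', ⟨Functor.Monoidal.μIso I.Q u u' ≪≫ I.Q.mapIso i ≪≫
    (Functor.Monoidal.εIso I.Q).symm⟩⟩

theorem IsInvertible.shiftQ {I : ThickIdeal K} {u : I.Quotient} (hu : IsInvertible u) (d : ℤ) :
    IsInvertible (u⟦d⟧) := by
  have Φ : tensorRight (I.Q.obj ((𝟙_ K)⟦d⟧)) ≅ shiftFunctor I.Quotient d :=
    Localization.liftNatIso I.Q I.carrier.trW
      (I.Q ⋙ tensorRight (I.Q.obj ((𝟙_ K)⟦d⟧))) (I.Q ⋙ shiftFunctor I.Quotient d) _ _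
      (I.tensorRightQ _ ≪≫ Functor.isoWhiskerRight (tensorRightShiftUnit d) I.Q ≪≫
        I.Q.commShiftIso d)
  exact (hu.tensor ((IsInvertible.unit.shift d).Q I)).of_iso (Φ.app u)

theorem Spectrum.isZero_or_isZero (P : Spectrum K) (X Y : P.Quotient) (h : IsZero (X ⊗ Y)) :
    IsZero X ∨ IsZero Y := by
  obtain ⟨A, ⟨a⟩⟩ := P.exists_iso_Q X
  obtain ⟨B, ⟨b⟩⟩ := P.exists_iso_Q Y
  have : IsZero (P.Q.obj (A ⊗ B)) :=
    h.of_iso ((Functor.Monoidal.μIso P.Q A B).symm ≪≫ (a ⊗ᵢ b))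
  exact (P.mem_or_mem A B ((P.isZero_Q_iff _).1 this)).imp
    (fun h => ((P.isZero_Q_iff _).2 h).of_iso a.symm)
    (fun h => ((P.isZero_Q_iff _).2 h).of_iso b.symm)

theorem Spectrum.isIso_or_isIso_of_add (P : Spectrum K) {X Y : P.Quotient} (hX : IsInvertible X)
    (a b : X ⟶ Y) (h : IsIso (a + b)) : IsIso a ∨ IsIso b :=
  hX.isIso_or_isIso_of_add P.quotientTensorRightShiftUnit P.isZero_or_isZero a b h

theorem Spectrum.not_isIso_zero (P : Spectrum K) {X Y : P.Quotient} (hX : IsInvertible X) :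
    ¬ IsIso (0 : X ⟶ Y) := by
  intro h
  have hX0 : IsZero X := by
    rw [IsZero.iff_id_eq_zero, ← IsIso.hom_inv_id (0 : X ⟶ Y), zero_comp]
  obtain ⟨X', ⟨i⟩⟩ := hX
  have h₁ : IsZero (X ⊗ X') := by
    rw [IsZero.iff_id_eq_zero, ← MonoidalCategory.id_whiskerRight, (IsZero.iff_id_eq_zero X).1 hX0]
    simp
  exact P.unit_notMem ((P.isZero_Q_iff _).1
    (h₁.of_iso ((Functor.Monoidal.εIso P.Q).symm ≪≫ i.symm)))

end QuotientMonoidal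

/-! ### Homogeneous primes and localizations of graded rings -/

section GradedRings

variable {A : ℤ → Type w} [∀ d, AddCommGroup (A d)] [DirectSum.GRing A]

theorem hom_mul_hom {d e : ℤ} (a : A d) (b : A e) :
    hom a * hom b = hom (GradedMonoid.GMul.mul a b) :=
  DirectSum.of_mul_of a b

theorem mul_mem_of_hom_mul_mem (S : AddSubgroup (Total A)) (r s : Total A)
    (h : ∀ d e, hom (r d) * hom (s e) ∈ S) : r * s ∈ S := by
  classical
  rw [← DirectSum.sum_support_of r, ← DirectSum.sum_support_of s, Finset.sum_mul_sum]
  exact S.sum_mem fun d _ => S.sum_mem fun e _ => h d e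

/-- The homogeneous prime of the elements all of whose components are not in `U`, where `U` is a
class of homogeneous elements that behaves like the class of units of a local ring. -/
def HomogeneousPrime.ofUnits (U : ∀ d, A d → Prop)
    (hadd : ∀ d (a b : A d), U d (a + b) → U d a ∨ U d b)
    (hmul : ∀ d e (a : A d) (b : A e), U (d + e) (GradedMonoid.GMul.mul a b) ↔ U d a ∧ U e b)
    (hzero : ∀ d, ¬ U d 0) (hone : U 0 GradedMonoid.GOne.one) : HomogeneousPrime A :=
  have hneg : ∀ d (a : A d), U d (-a) → U d a := fun d a h =>
    (hadd d (-a + a) (-a) (by simpa using h)).elim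
      (fun h => (hzero d (by simpa using h)).elim) fun h' => by
        -- `U` is stable under signs: `(-1)(-1) = 1 · 1` puts `-1` in `U`, and then `(-1)(-a) = 1 ·
        -- a` puts `a` in `U`.
        have : GradedMonoid.GMul.mul (-(GradedMonoid.GOne.one : A 0)) (-a) =
            (GradedMonoid.GMul.mul (GradedMonoid.GOne.one : A 0) a : A (0 + d)) := by
          have := hom_mul_hom (-(GradedMonoid.GOne.one : A 0)) (-a)
          rw [hom, hom, map_neg, map_neg, neg_mul_neg] at this
          exact (DirectSum.of_injective _ ((hom_mul_hom _ _).symm.trans this)).symm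
        have h₁ : U 0 (-(GradedMonoid.GOne.one : A 0)) := by
          have h2 : U (0 + 0) (GradedMonoid.GMul.mul (-(GradedMonoid.GOne.one : A 0))
              (-(GradedMonoid.GOne.one : A 0))) := by
            have := hom_mul_hom (-(GradedMonoid.GOne.one : A 0)) (-(GradedMonoid.GOne.one : A 0))
            rw [hom, map_neg, neg_mul_neg] at this
            rw [← DirectSum.of_injective _ ((hom_mul_hom _ _).symm.trans this), hmul]
            exact ⟨hone, hone⟩
          exact ((hmul _ _ _ _).1 h2).1
        have h2 := (hmul 0 d _ _).2 ⟨h₁, h'⟩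
        rw [this, hmul] at h2
        exact h2.2
  have hcomp : ∀ {d e : ℤ} (a : A d), ¬ U d a → ¬ U e (hom a e) := by
    intro d e a ha
    by_cases hde : d = e
    · subst hde
      rwa [hom, DirectSum.of_eq_same]
    · rw [hom, DirectSum.of_eq_of_ne _ _ _ (Ne.symm hde)]
      exact hzero e
  let S : AddSubgroup (Total A) :=
    { carrier := {r | ∀ d, ¬ U d (r d)}
      add_mem' := fun {r s} hr hs d h =>
        (hadd d _ _ (by simpa using h)).elim (hr d) (hs d)
      zero_mem' := fun d h => hzero d (by simpa using h)
      neg_mem' := fun {r} hr d h => hr d (hneg d _ h) }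
  have hS : ∀ {d : ℤ} (a : A d), hom a ∈ S ↔ ¬ U d a := fun {d} a =>
    ⟨fun h => by simpa [hom] using h d, fun h _ => hcomp a h⟩
  { toIdeal :=
      { carrier := S
        add_mem' := S.add_mem
        zero_mem' := S.zero_mem
        smul_mem' := fun r s hs => mul_mem_of_hom_mul_mem S r s fun d e => by
          rw [hom_mul_hom, hS, hmul]
          exact fun h => hs e h.2 }
    mul_mem_right := fun s r hs => mul_mem_of_hom_mul_mem S s r fun d e => by
      rw [hom_mul_hom, hS, hmul]
      exact fun h => hs d h.1
    component_mem := fun r hr d => (hS _).2 (hr d)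
    ne_top := by
      rw [Ne, Ideal.eq_top_iff_one]
      exact fun h => (hS (GradedMonoid.GOne.one : A 0)).1 h hone
    mem_or_mem := fun d e a b hab => by
      change hom a ∈ S ∨ hom b ∈ S
      replace hab : hom a * hom b ∈ S := hab
      rw [hom_mul_hom, hS, hmul] at hab
      rw [hS, hS]
      tauto }

theorem HomogeneousPrime.hom_mem_ofUnits (U : ∀ d, A d → Prop) (hadd hmul hzero hone) {d : ℤ}
    (a : A d) : hom a ∈ (HomogeneousPrime.ofUnits U hadd hmul hzero hone).toIdeal ↔ ¬ U d a := by
  constructor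
  · intro h
    have h' : ¬ U d (hom a d) := h d
    simpa [hom] using h'
  · intro ha e
    by_cases hde : d = e
    · subst hde
      rwa [hom, DirectSum.of_eq_same]
    · rw [hom, DirectSum.of_eq_of_ne _ _ _ (Ne.symm hde)]
      exact hzero e

theorem LocalRing.ofRing_mul_inv (I : Ideal (Total A)) (s : HomCompl I) :
    LocalRing.ofRing I (hom s.1.2) * LocalRing.inv I s = 1 := by
  rw [LocalRing.ofRing, LocalRing.inv, ← map_mul, RingQuot.mkRingHom_rel (LocRel.mul_inv s),
    map_one]

theorem LocalRing.inv_mul_ofRing (I : Ideal (Total A)) (s : HomCompl I) :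
    LocalRing.inv I s * LocalRing.ofRing I (hom s.1.2) = 1 := by
  rw [LocalRing.ofRing, LocalRing.inv, ← map_mul, RingQuot.mkRingHom_rel (LocRel.inv_mul s),
    map_one]

/-- A quotient of homogeneous elements outside of `I` is a homogeneous unit of the localization. -/
theorem LocalRing.exists_isUnit (I : Ideal (Total A)) {d e k : ℤ} (a : A d) (b : A e)
    (hk : d - e = k) (ha : hom a ∉ I) (hb : hom b ∉ I) :
    ∃ l, LocalRing.IsHomogeneous I k l ∧ IsUnit l := by
  let s : HomCompl I := ⟨⟨d, a⟩, ha⟩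
  let t : HomCompl I := ⟨⟨e, b⟩, hb⟩
  refine ⟨LocalRing.ofRing I (hom a) * LocalRing.inv I t, ?_, IsUnit.mul ?_ ?_⟩
  · subst hk
    exact (LocalRing.IsHomogeneous.ofRing a).mul (LocalRing.IsHomogeneous.inv t)
  · exact ⟨⟨_, _, ofRing_mul_inv I s, inv_mul_ofRing I s⟩, rfl⟩
  · exact ⟨⟨_, _, inv_mul_ofRing I t, ofRing_mul_inv I t⟩, rfl⟩

/-- The universal property of the localization. -/
def LocalRing.lift (I : Ideal (Total A)) {T : Type*} [Ring T] (φ : Total A →+* T)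
    (j : HomCompl I → T) (h₁ : ∀ s, φ (hom s.1.2) * j s = 1) (h₂ : ∀ s, j s * φ (hom s.1.2) = 1) :
    LocalRing I →+* T :=
  RingQuot.lift ⟨(FreeAlgebra.lift ℤ (Sum.elim φ j)).toRingHom, by
    intro a b h
    induction h with
    | one => simp
    | add => simp
    | mul => simp
    | mul_inv s => simpa using h₁ s
    | inv_mul s => simpa using h₂ s⟩

theorem LocalRing.lift_ofRing (I : Ideal (Total A)) {T : Type*} [Ring T] (φ : Total A →+* T)
    (j : HomCompl I → T) (h₁ h₂) (r : Total A) :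
    LocalRing.lift I φ j h₁ h₂ (LocalRing.ofRing I r) = φ r := by
  simp [LocalRing.lift, LocalRing.ofRing]

theorem LocalRing.lift_inv (I : Ideal (Total A)) {T : Type*} [Ring T] (φ : Total A →+* T)
    (j : HomCompl I → T) (h₁ h₂) (s : HomCompl I) :
    LocalRing.lift I φ j h₁ h₂ (LocalRing.inv I s) = j s := by
  simp [LocalRing.lift, LocalRing.inv]

/-- Homogeneity in the localization is generated inductively, so preservation of degrees need only
be checked on ring elements and formal inverses. -/
theorem LocalRing.exists_lift_eq_hom (I : Ideal (Total A)) {B : ℤ → Type*}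
    [∀ d, AddCommGroup (B d)] [DirectSum.GRing B] (φ : Total A →+* Total B)
    (j : HomCompl I → Total B) (h₁ h₂) (hφ : ∀ {d} (a : A d), ∃ b : B d, φ (hom a) = hom b)
    (hj : ∀ s : HomCompl I, ∃ b : B (-s.1.1), j s = hom b) {d : ℤ} {l : LocalRing I}
    (hl : LocalRing.IsHomogeneous I d l) :
    ∃ b : B d, LocalRing.lift I φ j h₁ h₂ l = hom b := by
  induction hl with
  | ofRing a => simpa only [lift_ofRing] using hφ a
  | inv s => simpa only [lift_inv] using hj s
  | add _ _ ih₁ ih₂ =>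
    obtain ⟨b₁, e₁⟩ := ih₁
    obtain ⟨b₂, e₂⟩ := ih₂
    exact ⟨b₁ + b₂, by rw [map_add, e₁, e₂, hom, hom, hom, map_add]⟩
  | mul _ _ ih₁ ih₂ =>
    obtain ⟨b₁, e₁⟩ := ih₁
    obtain ⟨b₂, e₂⟩ := ih₂
    exact ⟨_, by rw [map_mul, e₁, e₂, hom_mul_hom]⟩

end GradedRings

/-! ### Units of graded endomorphism rings, and functoriality -/

section GradedEnd

variable {C : Type*} [Category* C] [HasShift C ℤ] [Preadditive C]
  [∀ n : ℤ, (shiftFunctor C n).Additive]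

/-- A morphism `Σᵈ X ⟶ X` is an isomorphism. -/
def GEnd.IsIso {X : C} {d : ℤ} (a : GEnd X d) : Prop := CategoryTheory.IsIso (C := C) (X := X⟦d⟧) (Y := X) a

/-- The isomorphisms of the graded endomorphism ring of `X` behave like the units of a local
graded ring. -/
structure IsGradedLocal (X : C) : Prop where
  add (d : ℤ) (a b : X⟦d⟧ ⟶ X) : IsIso (a + b) → IsIso a ∨ IsIso b
  of_comp (d e k : ℤ) (f : (X⟦d⟧)⟦e⟧ ⟶ X⟦e⟧) (g : X⟦e⟧ ⟶ X) : IsIso (f ≫ g) → IsIso f ∧ IsIso g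
  zero (d : ℤ) : ¬ IsIso (0 : X⟦d⟧ ⟶ X)

theorem isIso_shiftMul_iff {X : C} (hX : IsGradedLocal X) {m n k : ℤ} (f : X⟦m⟧ ⟶ X)
    (g : X⟦n⟧ ⟶ X) (h : n + m = k) : IsIso (shiftMul f g h) ↔ IsIso f ∧ IsIso g := by
  rw [shiftMul, isIso_comp_left_iff]
  constructor
  · intro hi
    obtain ⟨h₁, h₂⟩ := hX.of_comp n m k _ _ hi
    exact ⟨h₂, isIso_of_reflects_iso g (shiftFunctor C m)⟩
  · rintro ⟨_, _⟩
    infer_instance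

theorem GEnd.isIso_mul_iff {X : C} (hX : IsGradedLocal X) {m n : ℤ} (f : GEnd X m)
    (g : GEnd X n) : (GradedMonoid.GMul.mul f g : GEnd X (m + n)).IsIso ↔ f.IsIso ∧ g.IsIso :=
  isIso_shiftMul_iff hX (X := X) f g (add_comm n m)

theorem GEnd.isIso_one (X : C) : (GradedMonoid.GOne.one : GEnd X 0).IsIso :=
  inferInstanceAs (CategoryTheory.IsIso ((shiftFunctorZero C ℤ).hom.app X))

/-- A homogeneous element which is an isomorphism is left invertible. -/
theorem GEnd.exists_hom_mul_eq_one {X : C} {d : ℤ} (a : GEnd X d) (ha : a.IsIso) :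
    ∃ b : GEnd X (-d), b.IsIso ∧ hom b * hom a = 1 := by
  let a' : X⟦d⟧ ⟶ X := a
  have ha' : CategoryTheory.IsIso a' := ha
  have hd : d + -d = 0 := by simp
  let b' : X⟦-d⟧ ⟶ X := inv (a'⟦-d⟧') ≫ (shiftFunctorAdd' C d (-d) 0 hd).inv.app X ≫
    (shiftFunctorZero C ℤ).hom.app X
  let b : GEnd X (-d) := b'
  refine ⟨b, inferInstanceAs (CategoryTheory.IsIso b'), (hom_mul_hom b a).trans ?_⟩
  have h : shiftMul b' a' hd = (shiftFunctorZero C ℤ).hom.app X := by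
    simp [shiftMul, b']
  refine DirectSum.of_eq_of_gradedMonoid_eq (A := GEnd X) ?_
  exact (mk_shiftMul (X := X) b' a' _ hd).trans (congrArg (Sigma.mk (0 : ℤ)) h)

theorem GEnd.exists_inv {X : C} {d : ℤ} (a : GEnd X d) (ha : a.IsIso) :
    ∃ b : GEnd X (-d), hom a * hom b = 1 ∧ hom b * hom a = 1 := by
  obtain ⟨b, hb, h⟩ := a.exists_hom_mul_eq_one ha
  obtain ⟨c, hc, h'⟩ := b.exists_hom_mul_eq_one hb
  refine ⟨b, ?_, h⟩
  rw [← left_inv_eq_right_inv h' h, h']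

/-- The homogeneous prime of the non-isomorphisms. -/
def IsGradedLocal.prime {X : C} (hX : IsGradedLocal X) : HomogeneousPrime (GEnd X) :=
  HomogeneousPrime.ofUnits (fun _ a => a.IsIso) hX.add
    (fun _ _ a b => GEnd.isIso_mul_iff hX a b) hX.zero (GEnd.isIso_one X)

/-- A non-isomorphism lies in the proper ideal `hX.prime`, which contains no unit. The inverse is
not assumed homogeneous. -/
theorem IsGradedLocal.isIso_of_isUnit {X : C} (hX : IsGradedLocal X) {d : ℤ} (a : GEnd X d)
    (ha : IsUnit (hom a)) : a.IsIso := by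
  by_contra h
  have := (HomogeneousPrime.hom_mem_ofUnits (A := GEnd X) (fun _ a => a.IsIso) hX.add
    (fun _ _ a b => GEnd.isIso_mul_iff hX a b) hX.zero (GEnd.isIso_one X) a).2 h
  exact hX.prime.ne_top (Ideal.eq_top_of_isUnit_mem _ this ha)

variable {D : Type*} [Category* D] [HasShift D ℤ] [Preadditive D]
  [∀ n : ℤ, (shiftFunctor D n).Additive] (F : C ⥤ D) [F.CommShift ℤ] [F.Additive]

/-- The morphism `Σᵈ F X ⟶ F X` induced by `Σᵈ X ⟶ X`. -/
def gEndMap {X : C} {d : ℤ} (a : X⟦d⟧ ⟶ X) : (F.obj X)⟦d⟧ ⟶ F.obj X :=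
  (F.commShiftIso d).inv.app X ≫ F.map a

theorem isIso_gEndMap_iff {X : C} {d : ℤ} (a : X⟦d⟧ ⟶ X) :
    IsIso (gEndMap F a) ↔ IsIso (F.map a) := by
  rw [gEndMap, isIso_comp_left_iff]

theorem gEndMap_shiftMul {X : C} {m n k : ℤ} (f : X⟦m⟧ ⟶ X) (g : X⟦n⟧ ⟶ X) (h : n + m = k) :
    gEndMap F (shiftMul f g h) = shiftMul (gEndMap F f) (gEndMap F g) h := by
  simp only [gEndMap, shiftMul, Functor.map_comp, F.commShiftIso_add' h,
    Functor.CommShift.isoAdd'_inv_app, Category.assoc]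
  have h₁ := (F.commShiftIso m).inv.naturality g
  have h₂ : F.map ((shiftFunctorAdd' C n m k h).inv.app X) ≫
      F.map ((shiftFunctorAdd' C n m k h).hom.app X) = 𝟙 (F.obj ((X⟦n⟧)⟦m⟧)) := by
    rw [← F.map_comp, Iso.inv_hom_id_app]
    exact F.map_id _
  dsimp at h₁
  rw [reassoc_of% h₂, ← reassoc_of% h₁]

theorem gEndMap_add {X : C} {d : ℤ} (a b : X⟦d⟧ ⟶ X) :
    gEndMap F (a + b) = gEndMap F a + gEndMap F b := by
  simp [gEndMap]

theorem gEndMap_zero (X : C) (d : ℤ) : gEndMap F (0 : X⟦d⟧ ⟶ X) = 0 := by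
  simp [gEndMap]

theorem gEndMap_one (X : C) :
    gEndMap F ((shiftFunctorZero C ℤ).hom.app X) = (shiftFunctorZero D ℤ).hom.app (F.obj X) := by
  simp only [gEndMap, F.commShiftIso_zero, Functor.CommShift.isoZero_inv_app, Category.assoc,
    ← Functor.map_comp]
  simp

theorem isIso_gEndMap_shiftMul_iff {X : C} (hX : IsGradedLocal (F.obj X)) {m n k : ℤ}
    (f : X⟦m⟧ ⟶ X) (g : X⟦n⟧ ⟶ X) (h : n + m = k) :
    IsIso (gEndMap F (shiftMul f g h)) ↔ IsIso (gEndMap F f) ∧ IsIso (gEndMap F g) := by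
  rw [gEndMap_shiftMul, isIso_shiftMul_iff hX]

/-- The homomorphism of graded endomorphism rings induced by a functor. -/
def gEndRingHom (X : C) : Total (GEnd X) →+* Total (GEnd (F.obj X)) :=
  DirectSum.toSemiring
    (fun d => (DirectSum.of (GEnd (F.obj X)) d).comp
      (AddMonoidHom.mk' (fun a : GEnd X d => (gEndMap F (X := X) a : GEnd (F.obj X) d))
        (gEndMap_add F (X := X))))
    (congrArg (DirectSum.of (GEnd (F.obj X)) 0) (gEndMap_one F X))
    (fun {i j} a b => by
      refine Eq.trans ?_ (hom_mul_hom _ _).symm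
      exact congrArg (DirectSum.of (GEnd (F.obj X)) (i + j)) (gEndMap_shiftMul F (X := X) a b _))

theorem gEndRingHom_hom {X : C} {d : ℤ} (a : GEnd X d) :
    gEndRingHom F X (hom a) = hom (A := GEnd (F.obj X)) (gEndMap F (X := X) a) :=
  DirectSum.toSemiring_of _ _ _ _ _

/-- If all homogeneous elements outside of `I` become invertible under `F`, then homogeneous units
of the localization at `I` yield isomorphisms. -/
theorem exists_isIso_of_isUnit {X : C} (hX : IsGradedLocal (F.obj X)) (I : Ideal (Total (GEnd X)))
    (hI : ∀ (d : ℤ) (a : X⟦d⟧ ⟶ X), hom (A := GEnd X) a ∉ I → IsIso (F.map a)) {d : ℤ}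
    {l : LocalRing I} (hl : LocalRing.IsHomogeneous I d l) (hu : IsUnit l) :
    ∃ a : (F.obj X)⟦d⟧ ⟶ F.obj X, IsIso a := by
  have h : ∀ s : HomCompl I, ∃ b : GEnd (F.obj X) (-s.1.1),
      gEndRingHom F X (hom s.1.2) * hom b = 1 ∧ hom b * gEndRingHom F X (hom s.1.2) = 1 := by
    intro s
    rw [gEndRingHom_hom]
    exact GEnd.exists_inv (X := F.obj X) (gEndMap F (X := X) s.1.2)
      ((isIso_gEndMap_iff F (X := X) s.1.2).2 (hI _ _ s.2))
  choose j h₁ h₂ using h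
  obtain ⟨b, hb⟩ := LocalRing.exists_lift_eq_hom I (gEndRingHom F X) (fun s => hom (j s)) h₁ h₂
    (fun a => ⟨_, gEndRingHom_hom F a⟩) (fun s => ⟨_, rfl⟩) hl
  exact ⟨b, hX.isIso_of_isUnit b (hb ▸ hu.map _)⟩

/-- The homogeneous prime of the elements which do not become invertible under `F`. -/
def IsGradedLocal.comap {X : C} (hX : IsGradedLocal (F.obj X)) : HomogeneousPrime (GEnd X) :=
  HomogeneousPrime.ofUnits (fun d a => IsIso (gEndMap F (X := X) (d := d) a))
    (fun d a b h => hX.add d _ _ (gEndMap_add F (X := X) a b ▸ h))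
    (fun d e a b => isIso_gEndMap_shiftMul_iff F hX (X := X) a b (add_comm e d))
    (fun d h => hX.zero d (gEndMap_zero F X d ▸ h))
    (by
      change IsIso (gEndMap F ((shiftFunctorZero C ℤ).hom.app X))
      rw [gEndMap_one]
      infer_instance)

theorem IsGradedLocal.hom_mem_comap_iff {X : C} (hX : IsGradedLocal (F.obj X)) {d : ℤ}
    (a : X⟦d⟧ ⟶ X) :
    hom (A := GEnd X) a ∈ (hX.comap F).toIdeal ↔ ¬ IsIso (F.map a) := by
  rw [← isIso_gEndMap_iff]
  exact HomogeneousPrime.hom_mem_ofUnits (A := GEnd X) _ _ _ _ _ _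

end GradedEnd

/-! ### Comparison of the periods of `K / P` and of a graded local ring -/

section Periods

variable {K : Type u} [Category.{v} K] [HasZeroObject K] [HasShift K ℤ]
  [Preadditive K] [∀ n : ℤ, (shiftFunctor K n).Additive] [Pretriangulated K]
  [MonoidalCategory K] [SymmetricCategory K] [TensorTriangulated K]

theorem Spectrum.isGradedLocal (P : Spectrum K) {Y : P.Quotient} (hY : IsInvertible Y) :
    IsGradedLocal Y where
  add d a b h := P.isIso_or_isIso_of_add (hY.shiftQ d) a b h
  of_comp d e _ f g _ :=
    IsInvertible.isIso_of_comp ((hY.shiftQ d).shiftQ e) (hY.shiftQ e) hY f g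
  zero d := P.not_isIso_zero (hY.shiftQ d)

variable {L : Type*} [Category* L] [HasShift L ℤ] (F : K ⥤ L) [F.CommShift ℤ]

/-- The functor `F` respects tensoring with objects, up to unspecified isomorphisms. -/
def RespectsTensor : Prop :=
  ∀ a b c : K, Nonempty (F.obj b ≅ F.obj c) → Nonempty (F.obj (a ⊗ b) ≅ F.obj (a ⊗ c))

variable {F}

/-- If `F b` is a shift of `F 𝟙`, then tensoring with `b` is the same shift after applying `F`. -/
theorem RespectsTensor.tensor_iso_shift (hF : RespectsTensor F) (a : K) {b : K} {d : ℤ}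
    (h : Nonempty (F.obj b ≅ (F.obj (𝟙_ K))⟦d⟧)) : Nonempty (F.obj (a ⊗ b) ≅ (F.obj a)⟦d⟧) := by
  obtain ⟨i⟩ := h
  obtain ⟨j⟩ := hF a b ((𝟙_ K)⟦d⟧) ⟨i ≪≫ ((F.commShiftIso d).app _).symm⟩
  exact ⟨j ≪≫ F.mapIso ((tensorRightShiftUnit d).app a) ≪≫ (F.commShiftIso d).app a⟩

variable {ι : Type} {x : ι → K}

theorem RespectsTensor.exists_iso_shift (hF : RespectsTensor F)
    (hx : ∀ i, ∃ d : ℤ, Nonempty (F.obj (x i) ≅ (F.obj (𝟙_ K))⟦d⟧)) {w : K}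
    (hw : PicMonoid x w) : ∃ d : ℤ, Nonempty (F.obj w ≅ (F.obj (𝟙_ K))⟦d⟧) := by
  induction hw with
  | of i => exact hx i
  | shift d => exact ⟨d, ⟨(F.commShiftIso d).app _⟩⟩
  | @tensor a b _ _ h₁ h₂ =>
    obtain ⟨d, ⟨i⟩⟩ := h₁
    obtain ⟨e, h₂⟩ := h₂
    obtain ⟨j⟩ := hF.tensor_iso_shift a h₂
    exact ⟨d + e, ⟨j ≪≫ (shiftFunctor L e).mapIso i ≪≫ ((shiftFunctorAdd L d e).app _).symm⟩⟩
  | iso i _ h =>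
    obtain ⟨d, ⟨j⟩⟩ := h
    exact ⟨d, ⟨F.mapIso i.symm ≪≫ j⟩⟩

theorem RespectsTensor.exists_inverse_iso_shift (hF : RespectsTensor F) {w w' : K}
    (hw : ∃ d : ℤ, Nonempty (F.obj w ≅ (F.obj (𝟙_ K))⟦d⟧)) (i : w ⊗ w' ≅ 𝟙_ K) :
    ∃ d : ℤ, Nonempty (F.obj w' ≅ (F.obj (𝟙_ K))⟦d⟧) := by
  obtain ⟨d, hw⟩ := hw
  obtain ⟨j⟩ := hF.tensor_iso_shift w' hw
  exact ⟨-d, ⟨(shiftEquiv L d).unitIso.app (F.obj w') ≪≫ (shiftFunctor L (-d)).mapIso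
    (j.symm ≪≫ F.mapIso (β_ w' w ≪≫ i))⟩⟩

/-- An isomorphism in `K / P` can be written as a fraction of morphisms with source inverse to an
object of the monoid generated by an ample family. -/
theorem IsAmple.exists_fraction (hK : IsRigid K) (hx : ∀ i, IsInvertible (x i)) (ha : IsAmple x)
    (P : Spectrum K) {a b : K} (f : P.Q.obj a ⟶ P.Q.obj b) (hf : IsIso f) :
    ∃ (w w' : K) (t : w' ⊗ a ⟶ a) (g : w' ⊗ a ⟶ b), PicMonoid x w ∧ Nonempty (w ⊗ w' ≅ 𝟙_ K) ∧
      P.ConeMem t ∧ P.ConeMem g := by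
  obtain ⟨c, t, g, ht, hg⟩ := P.exists_fraction f
  obtain ⟨Z, u, δ, hT, hZ⟩ := ht
  -- Ampleness gives a section `s` with `P ∈ U(s) ⊆ U(Z)`, where `Z` is the cone of the denominator.
  -- By existence of primes, `Z` then lies in the ideal generated by the cone of `s`.
  obtain ⟨_, ⟨m, hm, s, rfl⟩, hPs, hsub⟩ := ha.exists_subset_of_mem_open
    (show P ∈ {P : Spectrum K | P.carrier Z} from hZ)
    (TopologicalSpace.isOpen_generateFrom_of_mem ⟨Z, rfl⟩)
  let S : ObjectProperty K := fun c => ∃ (f : m ⟶ c) (g : c ⟶ (𝟙_ K)⟦(1 : ℤ)⟧),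
    Triangle.mk s f g ∈ distTriang K
  have hS : IsConeOfSections x S := fun c ⟨f, g, h⟩ => ⟨m, s, f, g, hm, h⟩
  have hSP : (ThickIdeal.generatedBy S).carrier ≤ P.carrier :=
    ThickIdeal.generatedBy_le fun c ⟨f, g, h⟩ => (P.carrier.trW_iff_of_distinguished _ h).1 hPs
  have hZS : (ThickIdeal.generatedBy S).carrier Z := by
    by_contra hn
    obtain ⟨P', hP', hn'⟩ := ThickIdeal.exists_prime hK _ hn
    obtain ⟨c, f, g, h⟩ := distinguished_cocone_triangle s
    exact hn' (hsub ⟨c, f, g, h, hP' _ (ThickIdeal.subset_generatedBy c ⟨f, g, h⟩)⟩)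
  obtain ⟨w, w', z, hw, hww, hz⟩ := hS.exists_denominator hx t ⟨Z, u, δ, hT, hZS⟩
  have hzP := ObjectProperty.trW_monotone hSP _ hz
  have hzQ := (P.isIso_Q_map_iff _).2 hzP
  refine ⟨w, w', z ≫ t, z ≫ g, hw, hww, hzP, (P.isIso_Q_map_iff _).1 ?_⟩
  rw [Functor.map_comp, ← hg, ← Functor.map_comp_assoc]
  infer_instance

variable [Preadditive L] [∀ n : ℤ, (shiftFunctor L n).Additive]

/-- The quotient `K ⟶ K / P` factors through an intermediate `L` in which the family becomes shifts
of the unit. This turns fractions with twisted source into fractions of homogeneous elements. -/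
theorem period_eq_ringPeriodAt (hK : IsRigid K) (hx : ∀ i, IsInvertible (x i)) (ha : IsAmple x)
    (P : Spectrum K) (hF : RespectsTensor F)
    (hF' : ∀ i, ∃ d : ℤ, Nonempty (F.obj (x i) ≅ (F.obj (𝟙_ K))⟦d⟧)) (G : L ⥤ P.Quotient)
    [G.CommShift ℤ] [G.Additive] (e : F ⋙ G ≅ P.Q) (I : Ideal (Total (GEnd (F.obj (𝟙_ K)))))
    (hI : ∀ (d : ℤ) (a : (F.obj (𝟙_ K))⟦d⟧ ⟶ F.obj (𝟙_ K)),
      hom (A := GEnd (F.obj (𝟙_ K))) a ∈ I ↔ ¬ IsIso (G.map a)) :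
    P.period = ringPeriodAt I := by
  have hX : IsGradedLocal (G.obj (F.obj (𝟙_ K))) :=
    P.isGradedLocal ((IsInvertible.unit.Q _).of_iso (e.app (𝟙_ K)).symm)
  -- Both periods are infima of sets of degrees, so equality of these sets also covers the value
  -- `0`.
  suffices h : ∀ d : ℤ, Nonempty (P.toThickIdeal.unit ≅ P.toThickIdeal.unit⟦d⟧) ↔
      ∃ l : LocalRing I, LocalRing.IsHomogeneous I d l ∧ IsUnit l by
    simp only [Spectrum.period, objPeriod, ringPeriodAt, gradedPeriod, h, Set.mem_ofPred_eq]
  intro d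
  constructor
  · rintro ⟨φ⟩
    obtain ⟨w, w', t, g, hw, ⟨i⟩, ht, hg⟩ := IsAmple.exists_fraction hK hx ha P
      (((P.Q.commShiftIso d).app (𝟙_ K)).hom ≫ φ.inv) inferInstance
    obtain ⟨j, hj⟩ := hF.exists_inverse_iso_shift (hF.exists_iso_shift hF' hw) i
    have hGF : ∀ {a b : K} (f : a ⟶ b), P.ConeMem f → IsIso (G.map (F.map f)) := fun f hf =>
      (NatIso.isIso_map_iff e f).2 ((P.isIso_Q_map_iff f).2 hf)
    -- In `L` the twist `w'` is `Σʲ 𝟙`. So `g` has degree `j + d`, while `t`, shifted back by `-d`,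
    -- has degree `j`; the quotient has degree `d`.
    obtain ⟨ψ⟩ : Nonempty (F.obj (w' ⊗ (𝟙_ K)⟦d⟧) ≅ (F.obj (𝟙_ K))⟦j + d⟧) := by
      obtain ⟨q⟩ := hj
      exact ⟨F.mapIso ((tensorRightShiftUnit d).app w') ≪≫ (F.commShiftIso d).app w' ≪≫
        (shiftFunctor L d).mapIso q ≪≫ ((shiftFunctorAdd L j d).app _).symm⟩
    have hgI := hGF g hg
    have htI := hGF t ht
    obtain ⟨τ, hτ⟩ : ∃ τ : (F.obj (𝟙_ K))⟦j + d⟧ ⟶ (F.obj (𝟙_ K))⟦d⟧, IsIso (G.map τ) := by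
      refine ⟨ψ.inv ≫ F.map t ≫ (F.commShiftIso d).hom.app _, ?_⟩
      rw [G.map_comp, G.map_comp]
      infer_instance
    have hτ' : IsIso (G.map (τ⟦-d⟧')) :=
      (NatIso.isIso_map_iff (G.commShiftIso (-d)) τ).2
        (inferInstanceAs (IsIso ((G.map τ)⟦-d⟧')))
    have κ : (F.obj (𝟙_ K))⟦j⟧ ≅ ((F.obj (𝟙_ K))⟦j + d⟧)⟦-d⟧ :=
      (shiftFunctorAdd' L (j + d) (-d) j (by simp)).app _
    have η : ((F.obj (𝟙_ K))⟦d⟧)⟦-d⟧ ≅ F.obj (𝟙_ K) := (shiftEquiv L d).unitIso.symm.app _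
    have h₁ : hom (A := GEnd (F.obj (𝟙_ K))) (d := j + d) (ψ.inv ≫ F.map g) ∉ I := by
      rw [hI, not_not, G.map_comp]
      infer_instance
    have h₂ : hom (A := GEnd (F.obj (𝟙_ K))) (d := j) (κ.hom ≫ τ⟦-d⟧' ≫ η.hom) ∉ I := by
      rw [hI, not_not, G.map_comp, G.map_comp]
      infer_instance
    exact LocalRing.exists_isUnit I _ _ (by simp) h₁ h₂
  · rintro ⟨l, hl, hu⟩
    -- Elements outside `I` become invertible under `G`, so the localization maps to the graded
    -- endomorphism ring of the unit of `K / P`, where homogeneous units are isomorphisms.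
    obtain ⟨a, _⟩ := exists_isIso_of_isUnit G hX I
      (fun d a h => not_not.1 fun hn => h ((hI d a).2 hn)) hl hu
    exact ⟨(e.app (𝟙_ K)).symm ≪≫ (asIso a).symm ≪≫ (shiftFunctor _ d).mapIso (e.app (𝟙_ K))⟩

end Periods

/-! ### The map to the central 2-ring and the charts of `P{x i}` -/

section Comparison

variable {K : Type u} [Category.{v} K] [HasZeroObject K] [HasShift K ℤ]
  [Preadditive K] [∀ n : ℤ, (shiftFunctor K n).Additive] [Pretriangulated K]
  [MonoidalCategory K] [SymmetricCategory K] [TensorTriangulated K]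

variable {ι : Type} {x : ι → K}

theorem PicGroup.of_mem {m : K} (hm : PicMonoid x m) : PicGroup x m :=
  ⟨m, 𝟙_ K, hm, PicMonoid.unit, ⟨ρ_ m⟩⟩

theorem PicGroup.tensor {g h : K} (hg : PicGroup x g) (hh : PicGroup x h) :
    PicGroup x (g ⊗ h) := by
  obtain ⟨m, n, hm, hn, ⟨i⟩⟩ := hg
  obtain ⟨m', n', hm', hn', ⟨i'⟩⟩ := hh
  exact ⟨m ⊗ m', n ⊗ n', hm.tensor hm', hn.tensor hn', ⟨⟨tensorμ g h n n', tensorδ g h n n', by simp, by simp⟩ ≪≫ (i ⊗ᵢ i')⟩⟩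

theorem PicGroup.isInvertible (hx : ∀ i, IsInvertible (x i)) {g : K} (hg : PicGroup x g) :
    IsInvertible g := by
  obtain ⟨m, n, hm, hn, ⟨i⟩⟩ := hg
  obtain ⟨m', ⟨j⟩⟩ := hm.isInvertible hx
  exact ⟨n ⊗ m', ⟨(α_ _ _ _).symm ≪≫ whiskerRightIso i m' ≪≫ j⟩⟩

theorem PicGroup.of_inverse {w w' : K} (hw : PicMonoid x w) (i : w ⊗ w' ≅ 𝟙_ K) :
    PicGroup x w' :=
  ⟨𝟙_ K, w, PicMonoid.unit, hw, ⟨β_ w' w ≪≫ i⟩⟩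

theorem centralRing_id {g : K} (hg : PicGroup x g) : centralRing x (𝟙 g) :=
  ⟨hg, hg, Or.inl ⟨𝟙_ K, PicMonoid.unit, ⟨(λ_ g).symm⟩⟩⟩

theorem centralRing_zero {g h : K} (hg : PicGroup x g) (hh : PicGroup x h) :
    centralRing x (0 : g ⟶ h) :=
  ⟨hg, hh, Or.inr rfl⟩

theorem centralRing_section {m : K} (hm : PicMonoid x m) (s : 𝟙_ K ⟶ m) : centralRing x s :=
  ⟨PicGroup.of_mem PicMonoid.unit, PicGroup.of_mem hm, Or.inl ⟨m, hm, ⟨(ρ_ m).symm⟩⟩⟩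

theorem centralRing_add {g h : K} {r r' : g ⟶ h} (hr : centralRing x r)
    (hr' : centralRing x r') : centralRing x (r + r') := by
  obtain ⟨hg, hh, h₁⟩ := hr
  obtain ⟨-, -, h₂⟩ := hr'
  refine ⟨hg, hh, ?_⟩
  rcases h₁ with h₁ | rfl
  · exact Or.inl h₁
  · rcases h₂ with h₂ | rfl
    · exact Or.inl h₂
    · exact Or.inr (add_zero 0)

theorem centralRing_comp {g h k : K} {r : g ⟶ h} {t : h ⟶ k} (hr : centralRing x r)
    (ht : centralRing x t) : centralRing x (r ≫ t) := by
  obtain ⟨hg, _, h₁⟩ := hr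
  obtain ⟨_, hk, h₂⟩ := ht
  refine ⟨hg, hk, ?_⟩
  rcases h₁ with ⟨m, hm, ⟨i⟩⟩ | rfl
  · rcases h₂ with ⟨n, hn, ⟨j⟩⟩ | rfl
    · exact Or.inl ⟨n ⊗ m, hn.tensor hm, ⟨j ≪≫ whiskerLeftIso n i ≪≫ (α_ _ _ _).symm⟩⟩
    · exact Or.inr comp_zero
  · exact Or.inr zero_comp

theorem centralRing_whiskerLeft {k g h : K} {r : g ⟶ h} (hk : PicGroup x k)
    (hr : centralRing x r) : centralRing x (k ◁ r) := by
  obtain ⟨hg, hh, h₁⟩ := hr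
  refine ⟨hk.tensor hg, hk.tensor hh, ?_⟩
  rcases h₁ with ⟨m, hm, ⟨i⟩⟩ | rfl
  · exact Or.inl ⟨m, hm, ⟨whiskerLeftIso k i ≪≫ (α_ _ _ _).symm ≪≫
      whiskerRightIso (β_ k m) g ≪≫ α_ _ _ _⟩⟩
  · exact Or.inr (by simp)

theorem centralRing_whiskerRight {k g h : K} {r : g ⟶ h} (hk : PicGroup x k)
    (hr : centralRing x r) : centralRing x (r ▷ k) := by
  obtain ⟨hg, hh, h₁⟩ := hr
  refine ⟨hg.tensor hk, hh.tensor hk, ?_⟩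
  rcases h₁ with ⟨m, hm, ⟨i⟩⟩ | rfl
  · exact Or.inl ⟨m, hm, ⟨whiskerRightIso i k ≪≫ α_ _ _ _⟩⟩
  · exact Or.inr (by simp)

theorem Spectrum.not_carrier (P : Spectrum K) {k : K} (hk : IsInvertible k) : ¬ P.carrier k := by
  intro h
  obtain ⟨k', ⟨i⟩⟩ := hk
  exact P.unit_notMem (P.carrier.prop_of_iso (β_ k' k ≪≫ i) (P.tensor_mem k' k h))

/-- The cone of `k ◁ r` is `k ⊗ cone r`; `P` is prime and does not contain the invertible object
`k`. -/
theorem Spectrum.coneMem_of_whiskerLeft (P : Spectrum K) {k g h : K} (hk : IsInvertible k)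
    {r : g ⟶ h} (hr : P.ConeMem (k ◁ r)) : P.ConeMem r := by
  obtain ⟨Z, u, δ, hT⟩ := distinguished_cocone_triangle r
  have h₁ : P.carrier (k ⊗ Z) := (P.carrier.trW_iff_of_distinguished _
    ((tensorLeft k).map_distinguished _ hT)).1 hr
  exact ⟨Z, u, δ, hT, (P.mem_or_mem _ _ h₁).resolve_left (P.not_carrier hk)⟩

theorem Spectrum.coneMem_of_whiskerRight (P : Spectrum K) {k g h : K} (hk : IsInvertible k)
    {r : g ⟶ h} (hr : P.ConeMem (r ▷ k)) : P.ConeMem r :=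
  P.coneMem_of_whiskerLeft hk
    ((P.carrier.trW.arrow_mk_iso_iff (Arrow.isoMk (β_ g k) (β_ h k) (by simp))).1 hr)

theorem Spectrum.coneMem_of_comp (P : Spectrum K) {g h k : K} (hg : IsInvertible g)
    (hh : IsInvertible h) (hk : IsInvertible k) {r : g ⟶ h} {t : h ⟶ k}
    (hrt : P.ConeMem (r ≫ t)) : P.ConeMem r ∧ P.ConeMem t := by
  have := (P.isIso_Q_map_iff _).2 hrt
  rw [Functor.map_comp] at this
  have := (hg.Q P.toThickIdeal).isIso_of_comp (hh.Q _) (hk.Q _) (P.Q.map r) (P.Q.map t)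
  exact this.imp (P.isIso_Q_map_iff _).1 (P.isIso_Q_map_iff _).1

/-- The point of the spectrum of the central 2-ring given by a prime tt-ideal. -/
def Spectrum.centralPrime (hx : ∀ i, IsInvertible (x i)) (P : Spectrum K) : CentralPrime x where
  carrier _ _ r := centralRing x r ∧ ¬ P.ConeMem r
  le_centralRing _ _ _ h := h.1
  zero_mem g h hg hh := ⟨centralRing_zero hg hh, fun hn => by
    have := (P.isIso_Q_map_iff _).2 hn
    rw [Functor.map_zero] at this
    exact P.not_isIso_zero ((hg.isInvertible hx).Q _) this⟩
  add_mem r r' hr hr' := ⟨centralRing_add hr.1 hr'.1, fun hn => by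
    have := (P.isIso_Q_map_iff _).2 hn
    rw [Functor.map_add] at this
    -- Closure under sums is exactly the locality of `K / P`.
    rcases P.isIso_or_isIso_of_add ((hr.1.1.isInvertible hx).Q _) _ _ this with h | h
    · exact hr.2 ((P.isIso_Q_map_iff _).1 h)
    · exact hr'.2 ((P.isIso_Q_map_iff _).1 h)⟩
  comp_mem r t hr ht := ⟨centralRing_comp hr.1 ht, fun hn => hr.2 (P.coneMem_of_comp
    (hr.1.1.isInvertible hx) (ht.1.isInvertible hx) (ht.2.1.isInvertible hx) hn).1⟩
  mem_comp t r ht hr := ⟨centralRing_comp ht hr.1, fun hn => hr.2 (P.coneMem_of_comp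
    (ht.1.isInvertible hx) (ht.2.1.isInvertible hx) (hr.1.2.1.isInvertible hx) hn).2⟩
  whiskerLeft_mem k _ _ r hk hr := ⟨centralRing_whiskerLeft hk hr.1,
    fun hn => hr.2 (P.coneMem_of_whiskerLeft (hk.isInvertible hx) hn)⟩
  whiskerRight_mem r k hk hr := ⟨centralRing_whiskerRight hk hr.1,
    fun hn => hr.2 (P.coneMem_of_whiskerRight (hk.isInvertible hx) hn)⟩
  ne_top h := by
    have h₁ : centralRing x (𝟙 (𝟙_ K)) := centralRing_id (PicGroup.of_mem PicMonoid.unit)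
    rw [← h] at h₁
    exact h₁.2 (MorphismProperty.id_mem _ _)
  mem_or_mem r s hr hs h := by
    by_contra! hn
    exact h.2 (P.carrier.trW.comp_mem _ _ (hn.1 hr) (hn.2 hs))

theorem Chart.isConeOfSections (s : Chart x) :
    IsConeOfSections x fun c => ∃ (i : ι) (f : (x i)⟦s.deg i⟧ ⟶ c) (g : c ⟶ (𝟙_ K)⟦(1 : ℤ)⟧),
      Triangle.mk (s.sec i) f g ∈ distTriang K :=
  fun _ ⟨i, f, g, h⟩ => ⟨_, s.sec i, f, g, (PicMonoid.of i).shift_mem _, h⟩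

theorem Chart.trW_sec (s : Chart x) (i : ι) : s.ideal.carrier.trW (s.sec i) := by
  obtain ⟨Z, f, g, h⟩ := distinguished_cocone_triangle (s.sec i)
  exact ⟨Z, f, g, h, ThickIdeal.subset_generatedBy Z ⟨i, f, g, h⟩⟩

theorem Chart.ideal_le (hx : ∀ i, IsInvertible (x i)) {P : Spectrum K} {s : Chart x}
    (hs : P.centralPrime hx ∈ s.domain) : s.ideal.carrier ≤ P.carrier := by
  refine ThickIdeal.generatedBy_le fun c ⟨i, f, g, h⟩ => ?_
  refine (P.carrier.trW_iff_of_distinguished _ h).1 ?_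
  by_contra hn
  exact hs i ⟨centralRing_section ((PicMonoid.of i).shift_mem _) _, hn⟩

theorem ThickIdeal.respectsTensor_Q (I : ThickIdeal K) : RespectsTensor I.Q :=
  fun a b c ⟨i⟩ => ⟨((I.tensorLeftQ a).app b).symm ≪≫ whiskerLeftIso (I.Q.obj a) i ≪≫
    (I.tensorLeftQ a).app c⟩

/-- The homogeneous elements of the prime of a chart at the image of `P` are those which do not
become invertible modulo `P`. -/
theorem Chart.hom_mem_primeAt_iff (hx : ∀ i, IsInvertible (x i)) (P : Spectrum K) (s : Chart x)
    (G : s.ideal.Quotient ⥤ P.Quotient) [G.CommShift ℤ] [G.Additive] (e : s.ideal.Q ⋙ G ≅ P.Q)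
    (d : ℤ) (a : s.ideal.unit⟦d⟧ ⟶ s.ideal.unit) :
    hom (A := s.ring) a ∈ s.primeAt (P.centralPrime hx) ↔ ¬ IsIso (G.map a) := by
  have hX : IsGradedLocal (G.obj s.ideal.unit) :=
    P.isGradedLocal ((IsInvertible.unit.Q _).of_iso (e.app (𝟙_ K)).symm)
  have hG : ∀ {g h : K} (f : g ⟶ h), IsIso (G.map (s.ideal.Q.map f)) ↔ P.ConeMem f := fun f =>
    (NatIso.isIso_map_iff e f).trans (P.isIso_Q_map_iff f)
  have key : ∀ {d : ℤ} (a : s.ideal.Q.obj ((𝟙_ K)⟦d⟧) ⟶ s.ideal.unit) {k : K}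
      (t : k ⟶ (𝟙_ K)⟦d⟧) (b : k ⟶ 𝟙_ K), s.ideal.carrier.trW t →
      s.ideal.Q.map t ≫ a = s.ideal.Q.map b →
      (IsIso (G.map ((s.ideal.Q.commShiftIso d).inv.app (𝟙_ K) ≫ a)) ↔ P.ConeMem b) := by
    intro d a k t b ht h
    have := (s.ideal.isIso_Q_map_iff t).2 ht
    rw [← hG, ← h, G.map_comp, G.map_comp, isIso_comp_left_iff, isIso_comp_left_iff]
  constructor
  · intro ha
    rw [← hX.hom_mem_comap_iff G]
    -- The span is controlled by a known prime: each generator `b ∘ t⁻¹` fails to become invertible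
    -- since `b` does, so it lies in the pullback along `G` of the non-isomorphisms.
    refine (Ideal.span_le.2 ?_ : s.primeAt (P.centralPrime hx) ≤ (hX.comap G).toIdeal) ha
    rintro _ ⟨d, a, k, t, b, -, ht, hb, hab, rfl⟩
    exact (hX.hom_mem_comap_iff G _).2 fun hn => hb.2 ((key a t b ht hab).1 hn)
  · intro ha
    obtain ⟨c, t, b, ht, hb⟩ := s.ideal.exists_fraction
      ((s.ideal.Q.commShiftIso d).hom.app (𝟙_ K) ≫ a)
    -- An arbitrary fraction may have a source outside the central 2-ring. Passing to `w' ⊗ Σᵈ 𝟙`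
    -- repairs this: `j` and `j'` show that its morphisms to `Σᵈ 𝟙` and to `𝟙` have degrees `w` and
    -- `Σ⁻ᵈ w` in `M`.
    obtain ⟨w, w', z, hw, ⟨i⟩, hz⟩ := s.isConeOfSections.exists_denominator hx t ht
    have hk : PicGroup x (w' ⊗ (𝟙_ K)⟦d⟧) :=
      (PicGroup.of_inverse hw i).tensor (PicGroup.of_mem (PicMonoid.shift d))
    have j : (𝟙_ K)⟦d⟧ ≅ w ⊗ (w' ⊗ (𝟙_ K)⟦d⟧) :=
      (λ_ _).symm ≪≫ whiskerRightIso i.symm _ ≪≫ α_ _ _ _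
    have j' : 𝟙_ K ≅ (w⟦-d⟧) ⊗ (w' ⊗ (𝟙_ K)⟦d⟧) :=
      (shiftEquiv K d).unitIso.app (𝟙_ K) ≪≫ (shiftFunctor K (-d)).mapIso (j ≪≫ β_ _ _) ≪≫
        ((tensorLeft _).commShiftIso (-d)).symm.app w ≪≫ β_ _ _
    have hab : s.ideal.Q.map (z ≫ t) ≫ (s.ideal.Q.commShiftIso d).hom.app (𝟙_ K) ≫ a =
        s.ideal.Q.map (z ≫ b) := by
      rw [Functor.map_comp, Category.assoc, hb, Functor.map_comp]
    have hia : (s.ideal.Q.commShiftIso d).inv.app (𝟙_ K) ≫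
        (s.ideal.Q.commShiftIso d).hom.app (𝟙_ K) ≫ a = a := by simp
    refine Ideal.subset_span ⟨d, _, _, z ≫ t, z ≫ b,
      ⟨hk, PicGroup.of_mem (PicMonoid.shift d), Or.inl ⟨w, hw, ⟨j⟩⟩⟩, hz,
      ⟨⟨hk, PicGroup.of_mem PicMonoid.unit, Or.inl ⟨_, hw.shift_mem _, ⟨j'⟩⟩⟩, fun hn => ha ?_⟩,
      hab, by rw [hia]⟩
    rw [← hia]
    exact (key _ _ _ hz hab).2 hn

/-- The ideal of the chart lies in `P`, so `K / P` is reached through `K[s⁻¹]`; there each `s i` is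
invertible and identifies `x i` with a shift of the unit. -/
theorem Chart.period_eq (hK : IsRigid K) (hx : ∀ i, IsInvertible (x i)) (ha : IsAmple x)
    (P : Spectrum K) (s : Chart x) (hs : P.centralPrime hx ∈ s.domain) :
    P.period = s.periodAt (P.centralPrime hx) := by
  have hinv : s.ideal.carrier.trW.IsInvertedBy P.Q := fun _ _ f hf =>
    (P.isIso_Q_map_iff f).2 (ObjectProperty.trW_monotone (Chart.ideal_le hx hs) f hf)
  let G : s.ideal.Quotient ⥤ P.Quotient := Localization.lift P.Q hinv s.ideal.Q
  let : G.CommShift ℤ := Functor.commShiftOfLocalization s.ideal.Q s.ideal.carrier.trW ℤ P.Q G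
  let e : s.ideal.Q ⋙ G ≅ P.Q := Localization.fac P.Q hinv s.ideal.Q
  have : G.Additive := by
    rw [Localization.functor_additive_iff s.ideal.Q s.ideal.carrier.trW]
    exact Functor.additive_of_iso e.symm
  refine period_eq_ringPeriodAt hK hx ha P s.ideal.respectsTensor_Q (fun i => ⟨-s.deg i, ?_⟩) G e _
    (s.hom_mem_primeAt_iff hx P G e)
  have := (s.ideal.isIso_Q_map_iff _).2 (s.trW_sec i)
  exact ⟨(shiftEquiv _ (s.deg i)).unitIso.app _ ≪≫ (shiftFunctor _ (-s.deg i)).mapIso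
    (asIso (s.ideal.Q.map (s.sec i)) ≪≫ (s.ideal.Q.commShiftIso (s.deg i)).app (x i)).symm⟩

end Comparison

/-! ### The comparison map for the graded endomorphism ring of the unit -/

section UnitComparison

/-- Finite intersections of subbasic open sets of the homogeneous spectrum are of the form `D(f)`. -/
theorem HomogeneousPrime.exists_basicOpen {A : ℤ → Type w} [∀ d, AddCommGroup (A d)]
    [DirectSum.GRing A] (S : Set (Set (HomogeneousPrime A))) (hS : S.Finite)
    (h : S ⊆ {U | ∃ (d : ℤ) (f : A d), U = {𝔭 : HomogeneousPrime A | hom f ∉ 𝔭.toIdeal}}) :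
    ∃ (d : ℤ) (f : A d), ⋂₀ S = {𝔭 : HomogeneousPrime A | hom f ∉ 𝔭.toIdeal} := by
  induction S, hS using Set.Finite.induction_on with
  | empty =>
    refine ⟨0, GradedMonoid.GOne.one, ?_⟩
    rw [Set.sInter_empty, eq_comm, Set.eq_univ_iff_forall]
    exact fun 𝔭 => (Ideal.ne_top_iff_one _).1 𝔭.ne_top
  | @insert U S _ _ ih =>
    obtain ⟨d, f, hf⟩ := h (Set.mem_insert _ _)
    obtain ⟨e, g, hg⟩ := ih fun V hV => h (Set.mem_insert_of_mem _ hV)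
    refine ⟨d + e, GradedMonoid.GMul.mul f g, ?_⟩
    rw [Set.sInter_insert, hf, hg]
    ext 𝔭
    rw [Set.mem_inter_iff, Set.mem_ofPred_eq, Set.mem_ofPred_eq, Set.mem_ofPred_eq, ← hom_mul_hom]
    constructor
    · rintro ⟨h₁, h₂⟩ h₃
      exact (𝔭.mem_or_mem _ _ _ _ h₃).elim h₁ h₂
    · intro h'
      exact ⟨fun h₁ => h' (𝔭.mul_mem_right _ _ h₁), fun h₂ => h' (𝔭.toIdeal.mul_mem_left _ h₂)⟩

variable {K : Type u} [Category.{v} K] [HasZeroObject K] [HasShift K ℤ]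
  [Preadditive K] [∀ n : ℤ, (shiftFunctor K n).Additive] [Pretriangulated K]
  [MonoidalCategory K] [SymmetricCategory K] [TensorTriangulated K]

/-- The comparison map to the homogeneous spectrum of the graded endomorphism ring of the unit. -/
def Spectrum.comparison (P : Spectrum K) : HomogeneousPrime (GEnd (𝟙_ K)) :=
  (P.isGradedLocal (IsInvertible.unit.Q P.toThickIdeal)).comap P.Q

theorem Spectrum.hom_mem_comparison_iff (P : Spectrum K) {d : ℤ} (f : (𝟙_ K)⟦d⟧ ⟶ 𝟙_ K) :
    hom (A := GEnd (𝟙_ K)) f ∈ P.comparison.toIdeal ↔ ¬ P.ConeMem f := by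
  rw [Spectrum.comparison, IsGradedLocal.hom_mem_comap_iff]
  exact (P.isIso_Q_map_iff f).not

theorem isOpen_invLocus {a b : K} (s : a ⟶ b) : IsOpen (invLocus s) := by
  obtain ⟨Z, f, g, h⟩ := distinguished_cocone_triangle s
  refine TopologicalSpace.isOpen_generateFrom_of_mem ⟨Z, ?_⟩
  ext P
  exact P.carrier.trW_iff_of_distinguished _ h

/-- The sets `D(f)` form a basis of the homogeneous spectrum and pull back to the sets `U(f)`.
Shifts of the unit lie in `M` for every family, so even the empty one is ample. -/
theorem isAmple_of_isInducing {ι : Type} (x : ι → K)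
    (h : Topology.IsInducing (Spectrum.comparison (K := K))) : IsAmple x := by
  refine TopologicalSpace.isTopologicalBasis_of_isOpen_of_nhds ?_ fun P U hP hU => ?_
  · rintro _ ⟨m, -, s, rfl⟩
    exact isOpen_invLocus s
  · obtain ⟨V, hV, rfl⟩ := h.isOpen_iff.1 hU
    obtain ⟨_, ⟨S, ⟨hS, hS'⟩, rfl⟩, hPS, hSV⟩ :=
      (TopologicalSpace.isTopologicalBasis_of_subbasis (α := HomogeneousPrime (GEnd (𝟙_ K)))
        rfl).exists_subset_of_mem_open hP hV
    obtain ⟨d, f, hf⟩ := HomogeneousPrime.exists_basicOpen S hS hS'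
    let f' : (𝟙_ K)⟦d⟧ ⟶ 𝟙_ K := f
    -- Shifting `f : Σᵈ 𝟙 ⟶ 𝟙` by `-d` makes it a section of an object of `M` without changing
    -- whether its cone lies in `P`.
    let s : 𝟙_ K ⟶ (𝟙_ K)⟦-d⟧ := (shiftEquiv K d).unitIso.hom.app (𝟙_ K) ≫ f'⟦-d⟧'
    have hs : invLocus s =
        Spectrum.comparison ⁻¹' ⋂₀ S := by
      ext P
      rw [hf]
      refine Iff.trans ?_ (P.hom_mem_comparison_iff f').not_left.symm
      refine (MorphismProperty.cancel_left_of_respectsIso P.carrier.trW _ _).trans ?_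
      exact MorphismProperty.IsCompatibleWithShift.iff P.carrier.trW f' (-d)
    refine ⟨_, ⟨_, PicMonoid.shift (-d), s, rfl⟩, ?_, ?_⟩
    · rw [hs]; exact hPS
    · rw [hs]; exact Set.preimage_mono hSV

theorem Spectrum.period_eq_of_isInducing (hK : IsRigid K)
    (h : Topology.IsInducing (Spectrum.comparison (K := K))) (P : Spectrum K) :
    P.period = ringPeriodAt P.comparison.toIdeal :=
  period_eq_ringPeriodAt (F := 𝟭 K) (x := (fun i => i.elim0 : Fin 0 → K)) hK (fun i => i.elim0)
    (isAmple_of_isInducing _ h) P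
    (fun a _ _ ⟨i⟩ => ⟨whiskerLeftIso a i⟩) (fun i => i.elim0) P.Q (Functor.leftUnitor _) _
    fun _ a => (P.hom_mem_comparison_iff a).trans (P.isIso_Q_map_iff a).symm.not

end UnitComparison

end TTPeriod

end

open TTPeriod

theorem mainTheorem7 {K : Type u} [Category.{v} K] [HasZeroObject K] [HasShift K ℤ]
    [Preadditive K] [∀ n : ℤ, (shiftFunctor K n).Additive] [Pretriangulated K]
    [MonoidalCategory K] [SymmetricCategory K] [TensorTriangulated K] (hK : IsRigid K) :
    -- a finite ample family of base-free line bundles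
    (∀ (N : ℕ) (x : Fin N → K), (∀ i, IsLineBundle (x i)) → (∀ i, IsBaseFree (x i)) → IsAmple x →
      ∃ comp : Spectrum K → CentralPrime x,
        (∀ (P : Spectrum K) (g h : K) (r : g ⟶ h),
          (comp P).carrier r ↔ centralRing x r ∧ ¬ P.ConeMem r) ∧
        ∀ P : Spectrum K, comp P ∈ gradedSchemeP x ∧
          ∀ s : Chart x, comp P ∈ s.domain → P.period = s.periodAt (comp P)) ∧
    -- the graded endomorphism ring of the unit
    ∃ comp : Spectrum K → HomogeneousPrime (GEnd (𝟙_ K)),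
      (∀ (P : Spectrum K) (d : ℤ) (f : (𝟙_ K)⟦d⟧ ⟶ 𝟙_ K),
        hom (A := GEnd (𝟙_ K)) f ∈ (comp P).toIdeal ↔ ¬ P.ConeMem f) ∧
      (Topology.IsEmbedding comp →
        ∀ P : Spectrum K, P.period = ringPeriodAt (comp P).toIdeal) := by
  refine ⟨fun N x hx hb ha => ?_, Spectrum.comparison, fun P d f => P.hom_mem_comparison_iff f,
    fun h P => P.period_eq_of_isInducing hK h.isInducing⟩
  have hx' : ∀ i, IsInvertible (x i) := fun i => (hx i).1
  refine ⟨Spectrum.centralPrime hx', fun P g h r => Iff.rfl, fun P => ⟨?_, fun s hs =>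
    Chart.period_eq hK hx' ha P s hs⟩⟩
  -- Base-freeness at `P` supplies, for each `i`, a section with cone in `P`; together they form a
  -- chart containing the image of `P`.
  choose d s hs using fun i => hb i P
  exact Set.mem_iUnion.2 ⟨⟨d, s⟩, fun i h => h.2 (hs i)⟩
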